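/- Let $\mathbb F$ be a field, $X$ a finite poset, $I(X)$ its incidence algebra over $\mathbb F$, $G$ an abelian group, and let $I(X)$ be endowed with a $G$-grading. By a triangular form of $I(X)$ we mean finite subgroups $H_1,\dots,H_t\subseteq G$ and orthogonal idempotents $e_1,\dots,e_t\in I(X)$ with $e_1+\cdots+e_t=1$, such that $e_iI(X)e_j=0$ for $i>j$, together with isomorphisms of $G$-graded algebras $\mathbb FH_i\cong e_iI(X)e_i$ for all $i$, by which $\mathbb FH_i$ is identified with $e_iI(X)e_i$. Thus $$ I(X)=\begin{pmatrix}\mathbb FH_1&M_{12}&\cdots&M_{1t}\\&\mathbb FH_2&\ddots&\vdots\\&&\ddots&M_{t-1,t}\\&&&\mathbb FH_t\end{pmatrix},\qquad M_{ij}=e_iI(X)e_j, $$ where $M_{ij}$ is a graded $(\mathbb FH_i,\mathbb FH_j)$-bimodule. (a) $I(X)$ has a triangular form in which, for every $i$, $\operatorname{char}\mathbb F$ does not divide $|H_i|$ and $\mathbb F$ contains a primitive root of unity of order $\exp H_i$. (b) For every triangular form of $I(X)$ and all $i<j$, put $\mathcal H_{ij}=H_i\cap H_j$. Then there exist $s\ge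 0$, pairwise distinct characters $\chi_1,\dots,\chi_s\colon\mathcal H_{ij}\to\mathbb F^\times$ and nonzero homogeneous elements $m_1,\dots,m_s\in M_{ij}$ such that $$ M_{ij}=\mathbb FH_i\,m_1\,\mathbb FH_j\oplus\cdots\oplus\mathbb FH_i\,m_s\,\mathbb FH_j $$ and $hm_\ell=\chi_\ell(h)\,m_\ell h$ for all $h\in\mathcal H_{ij}$ and $\ell=1,\dots,s$. Moreover, for each $\ell$, $\mathbb FH_i\,m_\ell\,\mathbb FH_j\cong(\mathbb F(H_iH_j))^{[\deg m_\ell]}$ as $G$-graded vector spaces, where $V^{[d]}$ denotes the vector space $V$ with the shifted grading $(V^{[d]})_g=V_{d^{-1}g}$, and $s\le|\mathcal H_{ij}|$. -/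

import Mathlib

/-!
The grading group `G` is abelian and written additively, so that gradings are Mathlib's
`GradedAlgebra`.  For a subgroup `H` of `G`, the group algebra `FH` is `AddMonoidAlgebra F H`, the
group element `h` being `AddMonoidAlgebra.single h 1`; the subgroup `H₁H₂` is `H₁ ⊔ H₂`.
-/

namespace GradedIncidence

/-- The group algebra of a subgroup `K` of `G`, with its natural `G`-grading: the component of
degree `g` is spanned by `g` if `g ∈ K`, and is zero otherwise. -/
noncomputable abbrev groupAlgebraGrading (F : Type*) [Field F] {G : Type*} [AddCommGroup G]
    (K : AddSubgroup G) : G → Submodule F (AddMonoidAlgebra F K) :=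
  AddMonoidAlgebra.gradeBy F (fun k : K => (k : G))

/-- The shift `V^{[d]}` of a `G`-graded vector space: `(V^{[d]})_g = V_{d⁻¹g}`. -/
def shift {F V G : Type*} [Field F] [AddCommGroup V] [Module F V] [AddCommGroup G]
    (𝒱 : G → Submodule F V) (d : G) : G → Submodule F V :=
  fun g => 𝒱 (-d + g)

/-- The family of subspaces that a grading `𝒜` of `A` induces on a subspace `N` of `A`. -/
def restrict {F A G : Type*} [Field F] [AddCommGroup A] [Module F A]
    (𝒜 : G → Submodule F A) (N : Submodule F A) : G → Submodule F N :=
  fun g => (𝒜 g).comap N.subtype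

/-- `V` and `W` are isomorphic as `G`-graded vector spaces. -/
def GradedIso {F V W G : Type*} [Field F] [AddCommGroup V] [Module F V] [AddCommGroup W]
    [Module F W] (𝒱 : G → Submodule F V) (𝒲 : G → Submodule F W) : Prop :=
  ∃ φ : V ≃ₗ[F] W, ∀ g, (𝒱 g).map (φ : V →ₗ[F] W) = 𝒲 g

/-- A presentation of a `G`-graded algebra `A` as a block upper triangular algebra whose diagonal
blocks are the group algebras `F H₁, …, F H_t` of finite subgroups of `G`. It is given by graded
isomorphisms `ι i` of `F H_i` onto the corners `e_i A e_i`, where the `e_i = ι i 1` are orthogonal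
idempotents with sum `1`; the block in position `(i, j)` is `e_i A e_j`, and it vanishes below
the diagonal. -/
structure TriangularForm {F A G : Type*} [Field F] [Ring A] [Algebra F A] [AddCommGroup G]
    (𝒜 : G → Submodule F A) (t : ℕ) where
  /-- The subgroups `H_i`. -/
  H : Fin t → AddSubgroup G
  finite : ∀ i, Finite (H i)
  /-- The (not necessarily unital) embedding of `F H_i` in `A`. -/
  ι : ∀ i, AddMonoidAlgebra F (H i) →ₙₐ[F] A
  injective : ∀ i, Function.Injective (ι i)
  graded : ∀ i (h : H i), ι i (AddMonoidAlgebra.single h 1) ∈ 𝒜 (h : G)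
  idem : CompleteOrthogonalIdempotents fun i => ι i 1
  surjective : ∀ i (a : A), ∃ b, ι i b = ι i 1 * a * ι i 1
  triangular : ∀ i j, j < i → ∀ a : A, ι i 1 * a * ι j 1 = 0

namespace TriangularForm

variable {F A G : Type*} [Field F] [Ring A] [Algebra F A] [AddCommGroup G]
  {𝒜 : G → Submodule F A} {t : ℕ}

/-- The image in `A` of the element `h` of the group `H_i`. -/
noncomputable def elt (D : TriangularForm 𝒜 t) (i : Fin t) (h : D.H i) : A :=
  D.ι i (AddMonoidAlgebra.single h 1)

/-- The `(F H_i, F H_j)`-bimodule `M_{ij} = e_i A e_j`. -/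
noncomputable def block (D : TriangularForm 𝒜 t) (i j : Fin t) : Submodule F A :=
  LinearMap.range (LinearMap.mulLeftRight F (D.ι i 1, D.ι j 1))

/-- The cyclic sub-bimodule `F H_i m F H_j`. -/
noncomputable def cyclic (D : TriangularForm 𝒜 t) (i j : Fin t) (m : A) : Submodule F A :=
  Submodule.span F {x | ∃ a b, x = D.ι i a * m * D.ι j b}

end TriangularForm

end GradedIncidence

/-! All that is used about the incidence algebra is its `Frame` of diagonal matrix units: the spaces
`ε x * A * ε y` are at most one-dimensional and respect the order, and an element with zero diagonal
is nilpotent. Frames can be conjugated by units, and a complete orthogonal family of idempotents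
becomes, in a suitable conjugate, a family of partial sums of the `ε x`. So each `e_i` may be taken
to be the sum of the `ε x` over a block `S_i` of points.

Structure of a diagonal block `F H`. It is commutative and contains `ε x` for `x ∈ S`, so `H` acts
on `ε x` by a character `χ_x`. Comparing coefficients gives `ε x = |H|⁻¹ ∑ χ_x(-h) h`. Hence `|H|`
is invertible in `F`, and the `χ_x` separate the points of `H` because the `ε x` sum to the unit of
the block; this forces the roots of unity.

Off-diagonal blocks. `ε x * A * ε y` has weight `χ_x / χ_y` on `H ∩ H'`, so the block is the direct
sum of its weight spaces. For `n` homogeneous of degree `d` and of this weight, the Fourier formulas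
show that the component of degree `d` of `ε x * n * ε y` is a nonzero multiple of `n`
(`Corner.exists_proj_eq_smul`). If `m` is homogeneous of the same weight with `ε x * m * ε y ≠ 0`,
thinness makes `ε x * n * ε y` a multiple of `ε x * m * ε y`, so `n ∈ FH m FH'`. Thus a nonzero
weight space is cyclic, and Dedekind's lemma bounds the number of weights.

Existence. Split the unit into as many nonzero orthogonal idempotents of degree `0` as possible. In
each corner, elements of degree `0` have constant diagonal, and a homogeneous element with one
nonzero diagonal entry has all of them nonzero. The decisive point is that the corner has no radical
(`LocalCorner.offDiag_eq_zero`); it is then a group algebra. Ordering the blocks by maximal height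
of their points gives the triangular shape. -/

namespace GradedIncidence

/-- A decomposition of the unit of an algebra `A` into orthogonal idempotents `ε x`, indexed by a
finite poset `X`, with respect to which `A` looks like the incidence algebra of `X`: the spaces
`ε x A ε y` are at most one-dimensional and vanish unless `x ≤ y`, and `ev x` is the diagonal
coefficient at `x`. -/
structure Frame (F A X : Type*) [Field F] [Ring A] [Algebra F A] [PartialOrder X] [Fintype X] where
  /-- The idempotents. -/
  ε : X → A
  /-- The diagonal coefficients. -/
  ev : X → A →ₐ[F] F
  complete : CompleteOrthogonalIdempotents ε
  diag : ∀ x a, ε x * a * ε x = ev x a • ε x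
  ev_self : ∀ x, ev x (ε x) = 1
  le_of_ne : ∀ x y a, ε x * a * ε y ≠ 0 → x ≤ y
  thin : ∀ x y, ∃ b, ∀ a, ∃ r : F, ε x * a * ε y = r • b
  nilpotent : ∀ a, (∀ x, ev x a = 0) → IsNilpotent a

/-! ### Conjugating a frame to fit given idempotents -/

namespace Frame

variable {F A X : Type*} [Field F] [Ring A] [Algebra F A] [PartialOrder X] [Fintype X]

theorem ev_of_ne (fr : Frame F A X) {x y : X} (h : x ≠ y) : fr.ev x (fr.ε y) = 0 := by
  have h1 := fr.diag x (fr.ε y)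
  rw [fr.complete.ortho h, zero_mul] at h1
  have h2 := congrArg (fr.ev x) h1
  simpa [fr.ev_self] using h2.symm

/-- Conjugation of a frame by a unit. -/
def conj (fr : Frame F A X) (u : Aˣ) : Frame F A X where
  ε x := ↑u⁻¹ * fr.ε x * u
  ev := fr.ev
  complete := by
    refine ⟨⟨fun x => ?_, fun x y h => ?_⟩, ?_⟩
    · change ↑u⁻¹ * fr.ε x * ↑u * (↑u⁻¹ * fr.ε x * ↑u) = ↑u⁻¹ * fr.ε x * ↑u
      have := fr.complete.idem x
      calc _ = ↑u⁻¹ * fr.ε x * (↑u * ↑u⁻¹) * fr.ε x * ↑u := by simp only [mul_assoc]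
        _ = ↑u⁻¹ * (fr.ε x * fr.ε x) * ↑u := by simp only [Units.mul_inv, mul_one, mul_assoc]
        _ = _ := by rw [this.eq]
    · change ↑u⁻¹ * fr.ε x * ↑u * (↑u⁻¹ * fr.ε y * ↑u) = 0
      calc _ = ↑u⁻¹ * fr.ε x * (↑u * ↑u⁻¹) * fr.ε y * ↑u := by simp only [mul_assoc]
        _ = ↑u⁻¹ * (fr.ε x * fr.ε y) * ↑u := by simp only [Units.mul_inv, mul_one, mul_assoc]
        _ = _ := by rw [fr.complete.ortho h]; simp
    · rw [← Finset.sum_mul, ← Finset.mul_sum, fr.complete.complete]; simp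
  diag x a := by
    calc _ = ↑u⁻¹ * (fr.ε x * (↑u * a * ↑u⁻¹) * fr.ε x) * ↑u := by simp only [mul_assoc]
      _ = _ := by
        rw [fr.diag]
        simp only [map_mul, mul_smul_comm, smul_mul_assoc]
        congr 1
        rw [mul_right_comm, ← map_mul]; simp
  ev_self x := by
    rw [map_mul, map_mul, mul_right_comm, ← map_mul]; simp [fr.ev_self]
  le_of_ne x y a h := by
    apply fr.le_of_ne x y (↑u * a * ↑u⁻¹)
    intro h0
    apply h
    calc _ = ↑u⁻¹ * (fr.ε x * (↑u * a * ↑u⁻¹) * fr.ε y) * ↑u := by simp only [mul_assoc]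
      _ = _ := by rw [h0]; simp
  thin x y := by
    obtain ⟨b, hb⟩ := fr.thin x y
    refine ⟨↑u⁻¹ * b * ↑u, fun a => ?_⟩
    obtain ⟨r, hr⟩ := hb (↑u * a * ↑u⁻¹)
    refine ⟨r, ?_⟩
    calc _ = ↑u⁻¹ * (fr.ε x * (↑u * a * ↑u⁻¹) * fr.ε y) * ↑u := by simp only [mul_assoc]
      _ = _ := by rw [hr]; simp
  nilpotent := fr.nilpotent

/-- Every complete family of orthogonal idempotents is, up to conjugation of the frame, a family of
partial sums of the frame. -/
theorem exists_adapted (fr : Frame F A X) {I : Type*} [Fintype I] [DecidableEq I] {e : I → A}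
    (he : CompleteOrthogonalIdempotents e) :
    ∃ (fr' : Frame F A X) (c : X → I), ∀ i, e i = ∑ x with c x = i, fr'.ε x := by
  classical
  -- The values of the character `ev x` on the `e i` sum to `1`, so one of them is nonzero; `c x`
  -- names such an index.
  have hc : ∀ x, ∃ i, fr.ev x (e i) ≠ 0 := by
    intro x
    by_contra! h
    have h1 := congrArg (fr.ev x) he.complete
    simp [map_sum, h] at h1
  choose c hc using hc
  have hc1 : ∀ x, fr.ev x (e (c x)) = 1 := by
    intro x
    have h1 := congrArg (fr.ev x) (he.idem (c x)).eq
    rw [map_mul] at h1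
    exact mul_right_cancel₀ (hc x) (by rw [h1, one_mul])
  -- `u` has all diagonal entries `1`, hence is a unit, and it intertwines `e i` with the sum of the
  -- `ε x` over `c x = i`.
  set u : A := ∑ x, fr.ε x * e (c x) with hu
  have hevu : ∀ x, fr.ev x u = 1 := by
    intro x
    rw [hu, map_sum, Finset.sum_eq_single x]
    · simp [fr.ev_self, hc1]
    · intro y _ hy
      simp [fr.ev_of_ne hy.symm]
    · simp
  have hunit : IsUnit u := by
    have h1 : IsNilpotent (u - 1) := fr.nilpotent _ fun x => by simp [hevu]
    simpa using h1.isUnit_one_add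
  obtain ⟨v, hv⟩ := hunit
  refine ⟨fr.conj v, c, fun i => ?_⟩
  have h1 : u * e i = (∑ x with c x = i, fr.ε x) * u := by
    rw [hu, Finset.sum_mul, Finset.sum_mul, Finset.sum_filter]
    refine Finset.sum_congr rfl fun x _ => ?_
    rw [mul_assoc]
    split_ifs with h
    · rw [h, (he.idem i).eq, Finset.mul_sum, Finset.sum_eq_single x]
      · rw [← mul_assoc, (fr.complete.idem x).eq, h]
      · intro y _ hy
        rw [← mul_assoc, fr.complete.ortho hy.symm, zero_mul]
      · simp
    · rw [he.ortho h, mul_zero]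
  rw [← hv] at h1
  calc e i = ↑v⁻¹ * (↑v * e i) := by simp
    _ = ∑ x with c x = i, (fr.conj v).ε x := by
      rw [h1, Finset.sum_mul, Finset.mul_sum]
      exact Finset.sum_congr rfl fun x _ => (mul_assoc _ _ _).symm

end Frame

/-! ### The frame of an incidence algebra -/

section Incidence

variable {F X : Type*} [Field F] [PartialOrder X] [DecidableEq X] [LocallyFiniteOrder X]

/-- The diagonal matrix unit at `x`. -/
def diagUnit (F : Type*) {X : Type*} [Field F] [PartialOrder X] [DecidableEq X] (x : X) :
    IncidenceAlgebra F X :=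
  ⟨fun a b => if a = x ∧ b = x then 1 else 0,
    fun _ _ h => if_neg fun h' => h (h'.1.trans h'.2.symm).le⟩

theorem diagUnit_mul_apply (x : X) (f : IncidenceAlgebra F X) (a b : X) :
    (diagUnit F x * f) a b = if a = x then f a b else 0 := by
  rw [IncidenceAlgebra.mul_apply]
  by_cases h : a ≤ b
  · rw [Finset.sum_eq_single a]
    · by_cases hx : a = x <;> simp [diagUnit, hx]
    · intro z _ hz
      simp only [diagUnit, IncidenceAlgebra.coe_mk]
      rw [if_neg, zero_mul]
      rintro ⟨rfl, rfl⟩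
      exact hz rfl
    · intro h'
      exact absurd (Finset.mem_Icc.2 ⟨le_rfl, h⟩) h'
  · rw [Finset.Icc_eq_empty h]
    simp [IncidenceAlgebra.apply_eq_zero_of_not_le h]

theorem mul_diagUnit_apply (x : X) (f : IncidenceAlgebra F X) (a b : X) :
    (f * diagUnit F x) a b = if b = x then f a b else 0 := by
  rw [IncidenceAlgebra.mul_apply]
  by_cases h : a ≤ b
  · rw [Finset.sum_eq_single b]
    · by_cases hx : b = x <;> simp [diagUnit, hx]
    · intro z _ hz
      simp only [diagUnit, IncidenceAlgebra.coe_mk]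
      rw [if_neg, mul_zero]
      rintro ⟨rfl, rfl⟩
      exact hz rfl
    · intro h'
      exact absurd (Finset.mem_Icc.2 ⟨h, le_rfl⟩) h'
  · rw [Finset.Icc_eq_empty h]
    simp [IncidenceAlgebra.apply_eq_zero_of_not_le h]

/-- The diagonal coefficient at `x`. -/
def diagEval (F : Type*) {X : Type*} [Field F] [PartialOrder X] [DecidableEq X]
    [LocallyFiniteOrder X] (x : X) : IncidenceAlgebra F X →ₐ[F] F :=
  AlgHom.ofLinearMap
    { toFun := fun f => f x x
      map_add' := fun _ _ => rfl
      map_smul' := fun _ _ => rfl }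
    (by simp)
    (fun f g => by simp)

/-- Only strict steps `a < z` contribute to the product, and each one shrinks the interval below
`b`. -/
theorem pow_apply_eq_zero (f : IncidenceAlgebra F X) (hf : ∀ x, f x x = 0) (n : ℕ) (a b : X)
    (h : (Finset.Icc a b).card ≤ n) : (f ^ n) a b = 0 := by
  induction n generalizing a with
  | zero =>
    apply IncidenceAlgebra.apply_eq_zero_of_not_le
    rw [Nat.le_zero, Finset.card_eq_zero] at h
    intro hab
    simpa [h] using Finset.left_mem_Icc.2 hab
  | succ n ih =>
    rw [pow_succ', IncidenceAlgebra.mul_apply]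
    refine Finset.sum_eq_zero fun z hz => ?_
    obtain ⟨haz, hzb⟩ := Finset.mem_Icc.1 hz
    rcases eq_or_ne a z with rfl | hne
    · rw [hf, zero_mul]
    · rw [ih z, mul_zero]
      have : (Finset.Icc z b).card < (Finset.Icc a b).card := by
        apply Finset.card_lt_card
        refine ⟨Finset.Icc_subset_Icc_left haz, fun h' => ?_⟩
        have := h' (Finset.left_mem_Icc.2 (haz.trans hzb))
        exact hne (le_antisymm haz (Finset.mem_Icc.1 this).1)
      omega

/-- The frame of diagonal matrix units of an incidence algebra. -/
def standardFrame (F X : Type*) [Field F] [PartialOrder X] [Fintype X] [DecidableEq X]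
    [LocallyFiniteOrder X] : Frame F (IncidenceAlgebra F X) X where
  ε := diagUnit F
  ev := diagEval F
  complete := by
    rw [CompleteOrthogonalIdempotents.iff_ortho_complete]
    constructor
    · intro x y h
      ext a b
      rw [diagUnit_mul_apply]
      simp only [diagUnit, IncidenceAlgebra.coe_mk, IncidenceAlgebra.zero_apply]
      grind
    · ext a b
      have : ∀ s : Finset X, (∑ x ∈ s, diagUnit F x) a b = ∑ x ∈ s, diagUnit F x a b := by
        intro s
        induction s using Finset.induction_on with
        | empty => rfl
        | insert y s hy ih => rw [Finset.sum_insert hy, Finset.sum_insert hy, ← ih]; rfl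
      rw [this]
      by_cases hab : a = b
      · subst hab
        simp [diagUnit]
      · simp only [diagUnit, IncidenceAlgebra.coe_mk, IncidenceAlgebra.one_apply, if_neg hab]
        refine Finset.sum_eq_zero fun x _ => if_neg ?_
        rintro ⟨rfl, rfl⟩
        exact hab rfl
  diag x f := by
    ext a b
    rw [mul_diagUnit_apply, diagUnit_mul_apply, IncidenceAlgebra.constSMul_apply]
    simp only [diagUnit, IncidenceAlgebra.coe_mk, diagEval]
    by_cases h1 : a = x <;> by_cases h2 : b = x <;> simp [h1, h2]
  ev_self x := by simp [diagEval, diagUnit]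
  le_of_ne x y f h := by
    by_contra hxy
    apply h
    ext a b
    rw [mul_diagUnit_apply, diagUnit_mul_apply, IncidenceAlgebra.zero_apply]
    by_cases h1 : a = x <;> by_cases h2 : b = y <;>
      simp [h1, h2, IncidenceAlgebra.apply_eq_zero_of_not_le hxy]
  thin x y := by
    by_cases hxy : x ≤ y
    · refine ⟨⟨fun a b => if a = x ∧ b = y then 1 else 0, fun a b h => if_neg ?_⟩,
        fun f => ⟨f x y, ?_⟩⟩
      · rintro ⟨rfl, rfl⟩
        exact h hxy
      · ext a b
        rw [mul_diagUnit_apply, diagUnit_mul_apply, IncidenceAlgebra.constSMul_apply]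
        by_cases h1 : a = x <;> by_cases h2 : b = y <;> simp [h1, h2]
    · refine ⟨0, fun f => ⟨0, ?_⟩⟩
      ext a b
      rw [mul_diagUnit_apply, diagUnit_mul_apply, smul_zero, IncidenceAlgebra.zero_apply]
      by_cases h1 : a = x <;> by_cases h2 : b = y <;>
        simp [h1, h2, IncidenceAlgebra.apply_eq_zero_of_not_le hxy]
  nilpotent f hf := by
    refine ⟨Fintype.card X, ?_⟩
    ext a b
    exact pow_apply_eq_zero f hf _ a b (Finset.card_le_univ _)

instance [Fintype X] : FiniteDimensional F (IncidenceAlgebra F X) :=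
  FiniteDimensional.of_injective
    ({ toFun := fun f => ⇑f
       map_add' := fun _ _ => rfl
       map_smul' := fun _ _ => rfl } : IncidenceAlgebra F X →ₗ[F] X → X → F)
    DFunLike.coe_injective

end Incidence

end GradedIncidence

namespace GradedIncidence

/-! ### Homogeneous components -/

section Proj

variable {F A G : Type*} [Field F] [Ring A] [Algebra F A] [AddCommGroup G] [DecidableEq G]
  (𝒜 : G → Submodule F A) [GradedAlgebra 𝒜]

theorem proj_mem (g : G) (a : A) : GradedAlgebra.proj 𝒜 g a ∈ 𝒜 g := by
  rw [GradedAlgebra.proj_apply]; exact SetLike.coe_mem _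

variable {𝒜}

theorem proj_same {g : G} {a : A} (h : a ∈ 𝒜 g) : GradedAlgebra.proj 𝒜 g a = a := by
  rw [GradedAlgebra.proj_apply, DirectSum.decompose_of_mem_same 𝒜 h]

theorem proj_of_ne {g g' : G} {a : A} (h : a ∈ 𝒜 g) (hg : g ≠ g') :
    GradedAlgebra.proj 𝒜 g' a = 0 := by
  rw [GradedAlgebra.proj_apply, DirectSum.decompose_of_mem_ne 𝒜 h hg]

theorem proj_mul_left {g d : G} {a m : A} (h : a ∈ 𝒜 g) :
    GradedAlgebra.proj 𝒜 (g + d) (a * m) = a * GradedAlgebra.proj 𝒜 d m := by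
  rw [GradedAlgebra.proj_apply, DirectSum.coe_decompose_mul_add_of_left_mem 𝒜 h,
    GradedAlgebra.proj_apply]

theorem proj_mul_right {g d : G} {a m : A} (h : a ∈ 𝒜 g) :
    GradedAlgebra.proj 𝒜 (d + g) (m * a) = GradedAlgebra.proj 𝒜 d m * a := by
  rw [GradedAlgebra.proj_apply, DirectSum.coe_decompose_mul_add_of_right_mem 𝒜 h,
    GradedAlgebra.proj_apply]

variable (𝒜)

theorem mem_of_proj_mem (N : Submodule F A) {a : A} (h : ∀ g, GradedAlgebra.proj 𝒜 g a ∈ N) :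
    a ∈ N := by
  classical
  rw [← DirectSum.sum_support_decompose 𝒜 a]
  refine N.sum_mem fun g _ => ?_
  rw [← GradedAlgebra.proj_apply]
  exact h g

theorem exists_proj_ne_zero {a : A} (h : a ≠ 0) : ∃ g, GradedAlgebra.proj 𝒜 g a ≠ 0 := by
  by_contra! h'
  exact h (by simpa using mem_of_proj_mem 𝒜 ⊥ (fun g => by simpa using h' g))

theorem iSupIndep_grading : iSupIndep 𝒜 :=
  (DirectSum.Decomposition.isInternal 𝒜).submodule_iSupIndep

variable {𝒜} in
theorem linearIndependent_of_mem {I : Type*} {v : I → A} {δ : I → G} (hδ : Function.Injective δ)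
    (hv : ∀ i, v i ∈ 𝒜 (δ i)) (h0 : ∀ i, v i ≠ 0) : LinearIndependent F v :=
  ((iSupIndep_grading 𝒜).comp hδ).linearIndependent _ hv h0

end Proj

/-! ### Corners that are group algebras: characters and Fourier expansion -/

/-- If the characters of a finite group separate its points, then the field contains a primitive
root of unity whose order is the exponent of the group. -/
theorem exists_isPrimitiveRoot_exponent {F H : Type*} [Field F] [AddCommGroup H] [Finite H]
    {I : Type*} (χ : I → AddChar H F) (hχ : ∀ h, (∀ i, χ i h = 1) → h = 0) :
    ∃ ζ : F, IsPrimitiveRoot ζ (AddMonoid.exponent H) := by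
  have hn : AddMonoid.exponent H ≠ 0 := AddMonoid.exponent_ne_zero_of_finite
  have : NeZero (AddMonoid.exponent H) := ⟨hn⟩
  rw [← card_rootsOfUnity_eq_iff_exists_isPrimitiveRoot]
  refine le_antisymm (card_rootsOfUnity _ _) (Nat.le_of_dvd Nat.card_pos ?_)
  -- All values of the characters lie in the group of roots of unity, so its order `N` satisfies `χ
  -- i (N • h) = 1` for all `i`; separation gives `N • h = 0`.
  refine AddMonoid.exponent_dvd_of_forall_nsmul_eq_zero fun h => hχ _ fun i => ?_
  have h1 : χ i h ^ AddMonoid.exponent H = 1 := by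
    rw [← AddChar.map_nsmul_eq_pow, AddMonoid.exponent_nsmul_eq_zero, AddChar.map_zero_eq_one]
  have h2 : rootsOfUnity.mkOfPowEq (χ i h) h1 ^ Nat.card (rootsOfUnity (AddMonoid.exponent H) F)
      = 1 := pow_card_eq_one'
  have h3 := congrArg (fun z : rootsOfUnity (AddMonoid.exponent H) F => ((z : Fˣ) : F)) h2
  rw [AddChar.map_nsmul_eq_pow]
  simpa using h3

/-- A corner `e A e`, `e` the sum of the idempotents in `S`, which is spanned by homogeneous
elements `b h` that multiply as the elements of a finite group `H` of degrees. -/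
structure Corner {F A X G : Type*} [Field F] [Ring A] [Algebra F A] [PartialOrder X] [Fintype X]
    [AddCommGroup G] (𝒜 : G → Submodule F A) (fr : Frame F A X) (S : Finset X)
    (H : AddSubgroup G) (b : H → A) : Prop where
  finite : Finite H
  mem : ∀ h : H, b h ∈ 𝒜 (h : G)
  mul : ∀ h k, b h * b k = b (h + k)
  zero : b 0 = ∑ x ∈ S, fr.ε x
  ne_zero : b 0 ≠ 0
  span : ∀ a, b 0 * a * b 0 ∈ Submodule.span F (Set.range b)

namespace Frame

variable {F A X : Type*} [Field F] [Ring A] [Algebra F A] [PartialOrder X] [Fintype X]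
  (fr : Frame F A X)

theorem ε_mul_sum {S : Finset X} {x : X} (hx : x ∈ S) :
    fr.ε x * ∑ y ∈ S, fr.ε y = fr.ε x :=
  fr.complete.mul_sum_of_mem hx

theorem sum_mul_ε {S : Finset X} {x : X} (hx : x ∈ S) :
    (∑ y ∈ S, fr.ε y) * fr.ε x = fr.ε x := by
  classical
  rw [Finset.sum_mul, Finset.sum_eq_single x]
  · exact (fr.complete.idem x).eq
  · intro y _ hy
    exact fr.complete.ortho hy
  · exact fun h => absurd hx h

theorem ev_sum {S : Finset X} {x : X} (hx : x ∈ S) : fr.ev x (∑ y ∈ S, fr.ε y) = 1 := by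
  classical
  rw [map_sum, Finset.sum_eq_single x]
  · exact fr.ev_self x
  · intro y _ hy
    exact fr.ev_of_ne hy.symm
  · exact fun h => absurd hx h

theorem exists_mul_mul_ne_zero {S T : Finset X} {m : A} (hS : (∑ x ∈ S, fr.ε x) * m = m)
    (hT : m * (∑ y ∈ T, fr.ε y) = m) (hm : m ≠ 0) :
    ∃ x ∈ S, ∃ y ∈ T, fr.ε x * m * fr.ε y ≠ 0 := by
  by_contra! h
  apply hm
  rw [← hT, ← hS, Finset.sum_mul, Finset.mul_sum]
  refine Finset.sum_eq_zero fun y hy => ?_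
  rw [Finset.sum_mul]
  exact Finset.sum_eq_zero fun x hx => h x hx y hy

end Frame

namespace Corner

variable {F A X G : Type*} [Field F] [Ring A] [Algebra F A] [PartialOrder X] [Fintype X]
  [AddCommGroup G] {𝒜 : G → Submodule F A} {fr : Frame F A X} {S : Finset X}
  {H : AddSubgroup G} {b : H → A}

theorem b_mul_neg (C : Corner 𝒜 fr S H b) (h : H) :
    b h * b (-h) = b 0 := by rw [C.mul, add_neg_cancel]

theorem b_neg_mul (C : Corner 𝒜 fr S H b) (h : H) :
    b (-h) * b h = b 0 := by rw [C.mul, neg_add_cancel]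

theorem b_ne_zero (C : Corner 𝒜 fr S H b) (h : H) : b h ≠ 0 := by
  intro h0
  apply C.ne_zero
  rw [← C.b_mul_neg h, h0, zero_mul]

theorem ev_zero (C : Corner 𝒜 fr S H b) {x : X} (hx : x ∈ S) : fr.ev x (b 0) = 1 := by
  rw [C.zero, fr.ev_sum hx]

theorem zero_mul_ε (C : Corner 𝒜 fr S H b) {x : X} (hx : x ∈ S) : b 0 * fr.ε x = fr.ε x := by
  rw [C.zero, fr.sum_mul_ε hx]

theorem ε_mul_zero (C : Corner 𝒜 fr S H b) {x : X} (hx : x ∈ S) : fr.ε x * b 0 = fr.ε x := by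
  rw [C.zero, fr.ε_mul_sum hx]

theorem ev_neg (C : Corner 𝒜 fr S H b) {x : X} (hx : x ∈ S) (h : H) :
    fr.ev x (b (-h)) * fr.ev x (b h) = 1 := by
  rw [← map_mul, C.b_neg_mul, C.ev_zero hx]

theorem nonempty (C : Corner 𝒜 fr S H b) : S.Nonempty := by
  rw [Finset.nonempty_iff_ne_empty]
  rintro rfl
  exact C.ne_zero (by rw [C.zero, Finset.sum_empty])

theorem comm (C : Corner 𝒜 fr S H b) {u v : A} (hu : u ∈ Submodule.span F (Set.range b))
    (hv : v ∈ Submodule.span F (Set.range b)) : u * v = v * u := by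
  induction hu using Submodule.span_induction with
  | mem u hu =>
    obtain ⟨h, rfl⟩ := hu
    induction hv using Submodule.span_induction with
    | mem v hv => obtain ⟨k, rfl⟩ := hv; rw [C.mul, C.mul, add_comm]
    | zero => simp
    | add v w _ _ h1 h2 => rw [mul_add, add_mul, h1, h2]
    | smul r v _ h1 => rw [mul_smul_comm, smul_mul_assoc, h1]
  | zero => simp
  | add u w _ _ h1 h2 => rw [mul_add, add_mul, h1, h2]
  | smul r u _ h1 => rw [mul_smul_comm, smul_mul_assoc, h1]

theorem ε_mem (C : Corner 𝒜 fr S H b) {x : X} (hx : x ∈ S) :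
    fr.ε x ∈ Submodule.span F (Set.range b) := by
  have := C.span (fr.ε x)
  rwa [C.zero_mul_ε hx, C.ε_mul_zero hx] at this

/-- `ε x` lies in the commutative corner, so `b h * ε x = ε x * b h * ε x`, which is a scalar
multiple of `ε x`. -/
theorem mul_ε (C : Corner 𝒜 fr S H b) {x : X} (hx : x ∈ S) (h : H) :
    b h * fr.ε x = fr.ev x (b h) • fr.ε x := by
  rw [← fr.diag, ← C.comm (Submodule.subset_span ⟨h, rfl⟩) (C.ε_mem hx), mul_assoc,
    (fr.complete.idem x).eq]

theorem ε_mul (C : Corner 𝒜 fr S H b) {x : X} (hx : x ∈ S) (h : H) :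
    fr.ε x * b h = fr.ev x (b h) • fr.ε x := by
  rw [← C.mul_ε hx, C.comm (Submodule.subset_span ⟨h, rfl⟩) (C.ε_mem hx)]

variable [DecidableEq G] [GradedAlgebra 𝒜]

theorem linearIndependent (C : Corner 𝒜 fr S H b) : LinearIndependent F b :=
  linearIndependent_of_mem (𝒜 := 𝒜) Subtype.val_injective C.mem C.b_ne_zero

/-- The eigenvector equation under `b (-k)` determines every coefficient of `ε x` from the one at
`0`; applying `ev x` then makes that coefficient the inverse of `|H|`. -/
theorem exists_ε_eq (C : Corner 𝒜 fr S H b) [Fintype H] {x : X} (hx : x ∈ S) :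
    ∃ c : F, c * (Nat.card H : F) = 1 ∧ fr.ε x = c • ∑ h, fr.ev x (b (-h)) • b h := by
  obtain ⟨f, hf⟩ := (Submodule.mem_span_range_iff_exists_fun F).1 (C.ε_mem hx)
  have hfk : ∀ k, f k = f 0 * fr.ev x (b (-k)) := by
    intro k
    have h1 := C.mul_ε hx (-k)
    rw [← hf, Finset.mul_sum, Finset.smul_sum] at h1
    have h2 : ∑ h, b (-k) * f h • b h = ∑ h, f (k + h) • b h := by
      rw [← Equiv.sum_comp (Equiv.addLeft k)]
      refine Finset.sum_congr rfl fun h _ => ?_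
      rw [mul_smul_comm, C.mul, Equiv.coe_addLeft, neg_add_cancel_left]
    rw [h2] at h1
    simp only [smul_smul] at h1
    have h3 := Fintype.linearIndependent_iff.1 C.linearIndependent
      (fun h => f (k + h) - fr.ev x (b (-k)) * f h)
      (by simp only [sub_smul, Finset.sum_sub_distrib, h1, sub_self]) 0
    rw [add_zero] at h3
    rw [sub_eq_zero.1 h3, mul_comm]
  have h4 : fr.ε x = f 0 • ∑ h, fr.ev x (b (-h)) • b h := by
    rw [← hf, Finset.smul_sum]
    refine Finset.sum_congr rfl fun h _ => ?_
    rw [smul_smul, ← hfk]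
  refine ⟨f 0, ?_, h4⟩
  have h5 := congrArg (fr.ev x) h4
  simp only [fr.ev_self, map_smul, map_sum, smul_eq_mul, C.ev_neg hx] at h5
  rw [h5]
  simp

theorem card_ne_zero (C : Corner 𝒜 fr S H b) : (Nat.card H : F) ≠ 0 := by
  have := C.finite
  have := Fintype.ofFinite H
  obtain ⟨x, hx⟩ := C.nonempty
  obtain ⟨c, hc, -⟩ := C.exists_ε_eq hx
  exact right_ne_zero_of_mul_eq_one hc

theorem not_ringChar_dvd (C : Corner 𝒜 fr S H b) : ¬ ringChar F ∣ Nat.card H := by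
  rw [← ringChar.spec]
  exact C.card_ne_zero

theorem exists_isPrimitiveRoot (C : Corner 𝒜 fr S H b) :
    ∃ ζ : F, IsPrimitiveRoot ζ (AddMonoid.exponent H) := by
  have := C.finite
  let χ : S → AddChar H F := fun x =>
    { toFun := fun h => fr.ev x (b h)
      map_zero_eq_one' := C.ev_zero x.2
      map_add_eq_mul' := fun h k => by rw [← C.mul, map_mul] }
  refine exists_isPrimitiveRoot_exponent χ fun h hh => ?_
  apply C.linearIndependent.injective
  have h1 : b h = b h * b 0 := by rw [C.mul, add_zero]
  rw [h1, C.zero, Finset.mul_sum]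
  refine Finset.sum_congr rfl fun x hx => ?_
  rw [C.mul_ε hx]
  have : fr.ev x (b h) = 1 := hh ⟨x, hx⟩
  rw [this, one_smul]

/-- The elements `b h * m` have distinct degrees, and in the expansion of `ε x * m` the coefficient
of `b 0 * m` is the inverse of `|H|`. -/
theorem ε_mul_ne_zero (C : Corner 𝒜 fr S H b) {x : X} (hx : x ∈ S) {d : G} {m : A} (hm : m ∈ 𝒜 d)
    (hbm : b 0 * m = m)
    (h0 : m ≠ 0) : fr.ε x * m ≠ 0 := by
  have := C.finite
  have := Fintype.ofFinite H
  obtain ⟨c, hc, hε⟩ := C.exists_ε_eq hx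
  intro h
  have hli : LinearIndependent F fun h : H => b h * m :=
    linearIndependent_of_mem (δ := fun h : H => (h : G) + d) (𝒜 := 𝒜)
      (fun h k hhk => Subtype.ext (add_right_cancel hhk))
      (fun h => SetLike.mul_mem_graded (C.mem h) hm)
      (fun h h1 => h0 (by rw [← hbm, ← C.b_neg_mul h, mul_assoc, h1, mul_zero]))
  have h2 := Fintype.linearIndependent_iff.1 hli (fun h => c * fr.ev x (b (-h)))
    (by
      rw [hε, smul_mul_assoc, Finset.sum_mul, Finset.smul_sum] at h
      rw [← h]
      refine Finset.sum_congr rfl fun k _ => ?_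
      rw [smul_mul_assoc, smul_smul]) 0
  rw [neg_zero, C.ev_zero hx, mul_one] at h2
  rw [h2, zero_mul] at hc
  exact zero_ne_one hc

end Corner

namespace Corner

variable {F A X G : Type*} [Field F] [Ring A] [Algebra F A] [PartialOrder X] [Fintype X]
  [AddCommGroup G] [DecidableEq G] {𝒜 : G → Submodule F A} [GradedAlgebra 𝒜] {fr : Frame F A X}
  {S S' : Finset X} {H H' : AddSubgroup G} {b : H → A} {b' : H' → A}

theorem exists_proj_eq_smul (C : Corner 𝒜 fr S H b) (C' : Corner 𝒜 fr S' H' b') {x y : X}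
    (hx : x ∈ S) (hy : y ∈ S') {d : G} {m : A} (hm : m ∈ 𝒜 d) (hmb : m * b' 0 = m)
    (hxy : ∀ (a : G) (h : a ∈ H) (h' : a ∈ H'),
      fr.ev y (b' ⟨a, h'⟩) • (b ⟨a, h⟩ * m) = fr.ev x (b ⟨a, h⟩) • (m * b' ⟨a, h'⟩)) :
    ∃ r : F, r ≠ 0 ∧ GradedAlgebra.proj 𝒜 d (fr.ε x * m * fr.ε y) = r • m := by
  classical
  have := C.finite
  have := C'.finite
  have := Fintype.ofFinite H
  have := Fintype.ofFinite H'
  obtain ⟨c, hc, hε⟩ := C.exists_ε_eq hx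
  obtain ⟨c', hc', hε'⟩ := C'.exists_ε_eq hy
  -- In the double Fourier expansion only the terms with `k = -h` have degree `d`. This requires `h
  -- ∈ H ∩ H'`, and by `hxy` each such term equals `m`.
  have hterm : ∀ h : H, ∑ k : H', GradedAlgebra.proj 𝒜 d
      ((fr.ev x (b (-h)) • b h) * m * (fr.ev y (b' (-k)) • b' k)) =
      if (h : G) ∈ H' then m else 0 := by
    intro h
    have hmem : ∀ k : H', b h * m * b' k ∈ 𝒜 ((h : G) + d + (k : G)) := fun k =>
      SetLike.mul_mem_graded (SetLike.mul_mem_graded (C.mem h) hm) (C'.mem k)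
    simp only [smul_mul_assoc, mul_smul_comm, map_smul]
    split_ifs with hh
    · rw [Finset.sum_eq_single (-⟨h, hh⟩ : H')]
      · rw [neg_neg, proj_same]
        · have h1 := hxy h h.2 hh
          calc _ = fr.ev x (b (-h)) • ((fr.ev y (b' ⟨h, hh⟩) • (b h * m)) * b' (-⟨h, hh⟩)) := by
                rw [smul_mul_assoc, smul_comm]
            _ = (fr.ev x (b (-h)) * fr.ev x (b h)) • (m * (b' ⟨h, hh⟩ * b' (-⟨h, hh⟩))) := by
                rw [h1, smul_mul_assoc, smul_smul, mul_assoc]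
            _ = m := by rw [C.ev_neg hx, C'.b_mul_neg, hmb, one_smul]
        · have := hmem (-⟨h, hh⟩)
          simpa using this
      · intro k _ hk
        rw [proj_of_ne (hmem k), smul_zero, smul_zero]
        intro h1
        apply hk
        ext
        have : (h : G) + k = 0 := by
          have h2 : (h : G) + k + d = 0 + d := by rw [zero_add, add_right_comm, h1]
          exact add_right_cancel h2
        simpa using eq_neg_of_add_eq_zero_right this
      · simp
    · refine Finset.sum_eq_zero fun k _ => ?_
      rw [proj_of_ne (hmem k), smul_zero, smul_zero]
      intro h1
      apply hh
      have : (h : G) + k = 0 := by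
        have h2 : (h : G) + k + d = 0 + d := by rw [zero_add, add_right_comm, h1]
        exact add_right_cancel h2
      rw [eq_neg_of_add_eq_zero_left this]
      exact H'.neg_mem k.2
  -- The last factor counts `H ∩ H'`; it is nonzero in `F` because it divides `|H|`.
  refine ⟨c * c' * (Nat.card (H'.addSubgroupOf H) : F), ?_, ?_⟩
  · refine mul_ne_zero (mul_ne_zero (left_ne_zero_of_mul_eq_one hc)
      (left_ne_zero_of_mul_eq_one hc')) ?_
    intro h0
    obtain ⟨n, hn⟩ := AddSubgroup.card_addSubgroup_dvd_card (H'.addSubgroupOf H)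
    apply C.card_ne_zero
    rw [hn, Nat.cast_mul, h0, zero_mul]
  · have hcard : Nat.card (H'.addSubgroupOf H) =
        (Finset.univ.filter fun h : H => (h : G) ∈ H').card := by
      rw [Nat.card_eq_fintype_card, Fintype.card_subtype]
      rfl
    rw [hε, hε', smul_mul_assoc, smul_mul_assoc, mul_smul_comm, map_smul,
      map_smul, Finset.sum_mul, Finset.sum_mul, map_sum]
    simp only [Finset.mul_sum, map_sum, hterm]
    rw [← Finset.sum_filter, Finset.sum_const, hcard, mul_smul,
      mul_smul, Nat.cast_smul_eq_nsmul]

end Corner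

end GradedIncidence

namespace GradedIncidence

/-! ### Weight spaces of a bimodule between two corners -/

section Weight

variable {F A X G : Type*} [Field F] [Ring A] [Algebra F A] [PartialOrder X] [Fintype X]
  [AddCommGroup G] {𝒜 : G → Submodule F A} {fr : Frame F A X}
  {S S' : Finset X} {H H' : AddSubgroup G} {b : H → A} {b' : H' → A}

/-- The elements `m` of the bimodule `b 0 * A * b' 0` such that `h m = χ(h) m h` for `h` in the
intersection of the two groups. -/
def weightSpace (b : H → A) (b' : H' → A) (χ : AddChar (H ⊓ H' : AddSubgroup G) F) :
    Submodule F A where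
  carrier := {m | b 0 * m = m ∧ m * b' 0 = m ∧ ∀ (a : G) (h : a ∈ H) (h' : a ∈ H'),
    b ⟨a, h⟩ * m = χ ⟨a, h, h'⟩ • (m * b' ⟨a, h'⟩)}
  zero_mem' := by simp
  add_mem' := by
    rintro m n ⟨h1, h2, h3⟩ ⟨k1, k2, k3⟩
    refine ⟨by rw [mul_add, h1, k1], by rw [add_mul, h2, k2], fun a h h' => ?_⟩
    rw [mul_add, h3 a h h', k3 a h h', add_mul, smul_add]
  smul_mem' := by
    rintro r m ⟨h1, h2, h3⟩
    refine ⟨by rw [mul_smul_comm, h1], by rw [smul_mul_assoc, h2], fun a h h' => ?_⟩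
    rw [mul_smul_comm, h3 a h h', smul_mul_assoc, smul_comm]

/-- The span of the elements `h m k`. -/
def orbitSpan (F : Type*) [Field F] [Algebra F A] (b : H → A) (b' : H' → A) (m : A) :
    Submodule F A :=
  Submodule.span F (Set.range fun p : H × H' => b p.1 * m * b' p.2)

theorem mul_mul_mem_orbitSpan {m u v : A} (hu : u ∈ Submodule.span F (Set.range b))
    (hv : v ∈ Submodule.span F (Set.range b')) : u * m * v ∈ orbitSpan F b b' m := by
  induction hu using Submodule.span_induction with
  | mem u hu =>
    obtain ⟨h, rfl⟩ := hu
    induction hv using Submodule.span_induction with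
    | mem v hv => obtain ⟨k, rfl⟩ := hv; exact Submodule.subset_span ⟨(h, k), rfl⟩
    | zero => simp
    | add v w _ _ h1 h2 => rw [mul_add]; exact add_mem h1 h2
    | smul r v _ h1 => rw [mul_smul_comm]; exact Submodule.smul_mem _ _ h1
  | zero => simp
  | add u w _ _ h1 h2 => rw [add_mul, add_mul]; exact add_mem h1 h2
  | smul r u _ h1 => rw [smul_mul_assoc, smul_mul_assoc]; exact Submodule.smul_mem _ _ h1

namespace Corner

/-- The quotient of the characters by which two corners act at `x` and `y`, on the intersection of
the two groups. -/
def pairChar (C : Corner 𝒜 fr S H b) (C' : Corner 𝒜 fr S' H' b') {x y : X} (hx : x ∈ S)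
    (hy : y ∈ S') : AddChar (H ⊓ H' : AddSubgroup G) F where
  toFun a := fr.ev x (b ⟨a, a.2.1⟩) * fr.ev y (b' (-⟨a, a.2.2⟩))
  map_zero_eq_one' := by
    have h1 := C.ev_zero hx
    have h2 := C'.ev_zero hy
    rw [← neg_zero] at h2
    exact (congrArg₂ (· * ·) h1 h2).trans (one_mul 1)
  map_add_eq_mul' a a' := by
    have h1 : b ⟨(a + a' : (H ⊓ H' : AddSubgroup G)), (a + a').2.1⟩ =
        b ⟨a, a.2.1⟩ * b ⟨a', a'.2.1⟩ := by rw [C.mul]; rfl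
    have h2 : b' (-⟨(a + a' : (H ⊓ H' : AddSubgroup G)), (a + a').2.2⟩) =
        b' (-⟨a, a.2.2⟩) * b' (-⟨a', a'.2.2⟩) := by
      rw [C'.mul, ← neg_add]; rfl
    rw [h1, h2, map_mul, map_mul]
    ring

theorem mul_mul_ε_mem_weightSpace (C : Corner 𝒜 fr S H b) (C' : Corner 𝒜 fr S' H' b') {x y : X}
    (hx : x ∈ S) (hy : y ∈ S') (m : A) :
    fr.ε x * m * fr.ε y ∈ weightSpace b b' (C.pairChar C' hx hy) := by
  refine ⟨?_, ?_, fun a h h' => ?_⟩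
  · rw [← mul_assoc, ← mul_assoc, C.zero_mul_ε hx]
  · rw [mul_assoc, C'.ε_mul_zero hy]
  · rw [← mul_assoc, ← mul_assoc, C.mul_ε hx, mul_assoc _ _ (b' _), C'.ε_mul hy]
    rw [mul_smul_comm, smul_smul, smul_mul_assoc, smul_mul_assoc]
    congr 1
    change _ = fr.ev x (b ⟨a, h⟩) * fr.ev y (b' (-⟨a, h'⟩)) * _
    rw [mul_assoc, C'.ev_neg hy, mul_one]

theorem eq_pairChar (C : Corner 𝒜 fr S H b) (C' : Corner 𝒜 fr S' H' b') {x y : X}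
    (hx : x ∈ S) (hy : y ∈ S') {χ : AddChar (H ⊓ H' : AddSubgroup G) F} {m : A}
    (hm : m ∈ weightSpace b b' χ) (h0 : fr.ε x * m * fr.ε y ≠ 0) : χ = C.pairChar C' hx hy := by
  ext a
  have h1 := congrArg (fun z => fr.ε x * z * fr.ε y) (hm.2.2 a a.2.1 a.2.2)
  simp only [mul_smul_comm, smul_mul_assoc] at h1
  rw [← mul_assoc, C.ε_mul hx, ← mul_assoc, mul_assoc _ (b' _), C'.mul_ε hy, mul_smul_comm,
    smul_mul_assoc, smul_mul_assoc, smul_smul, ← sub_eq_zero, ← sub_smul, smul_eq_zero,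
    or_iff_left h0, sub_eq_zero] at h1
  change _ = fr.ev x (b ⟨a, a.2.1⟩) * fr.ev y (b' (-⟨a, a.2.2⟩))
  rw [h1, mul_assoc, mul_comm (fr.ev y _), C'.ev_neg hy, mul_one]

/-- If `ε x * m * ε y ≠ 0`, the weight of `m` must be the character attached to `x, y`; so `a ↦ ε x
* a * ε y` kills every other weight space but not `m`. -/
theorem iSupIndep_weightSpace (C : Corner 𝒜 fr S H b) (C' : Corner 𝒜 fr S' H' b') :
    iSupIndep fun χ : AddChar (H ⊓ H' : AddSubgroup G) F => weightSpace b b' χ := by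
  intro χ
  rw [Submodule.disjoint_def]
  intro m hm hm'
  by_contra h0
  obtain ⟨x, hx, y, hy, hxy⟩ := fr.exists_mul_mul_ne_zero (C.zero ▸ hm.1) (C'.zero ▸ hm.2.1) h0
  have h1 : (⨆ ψ, ⨆ (_ : ψ ≠ χ), weightSpace b b' ψ) ≤
      LinearMap.ker (LinearMap.mulLeftRight F (fr.ε x, fr.ε y)) := by
    refine iSup₂_le fun ψ hψ n hn => ?_
    rw [LinearMap.mem_ker, LinearMap.mulLeftRight_apply]
    by_contra hne
    exact hψ ((C.eq_pairChar C' hx hy hn hne).trans (C.eq_pairChar C' hx hy hm hxy).symm)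
  have h2 := h1 hm'
  rw [LinearMap.mem_ker, LinearMap.mulLeftRight_apply] at h2
  exact hxy h2

theorem mem_iSup_weightSpace (C : Corner 𝒜 fr S H b) (C' : Corner 𝒜 fr S' H' b') {m : A}
    (hbm : b 0 * m = m) (hmb : m * b' 0 = m) : m ∈ ⨆ χ, weightSpace (F := F) b b' χ := by
  rw [← hmb, ← hbm, C.zero, C'.zero, Finset.sum_mul, Finset.mul_sum]
  refine Submodule.sum_mem _ fun y hy => ?_
  rw [Finset.sum_mul]
  exact Submodule.sum_mem _ fun x hx =>
    Submodule.mem_iSup_of_mem _ (C.mul_mul_ε_mem_weightSpace C' hx hy m)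

theorem orbitSpan_le_weightSpace (C : Corner 𝒜 fr S H b) (C' : Corner 𝒜 fr S' H' b')
    {χ : AddChar (H ⊓ H' : AddSubgroup G) F} {m : A} (hm : m ∈ weightSpace b b' χ) :
    orbitSpan F b b' m ≤ weightSpace b b' χ := by
  rw [orbitSpan, Submodule.span_le]
  rintro _ ⟨⟨h, k⟩, rfl⟩
  refine ⟨?_, ?_, fun a ha ha' => ?_⟩
  · simp only [← mul_assoc, C.mul, zero_add]
  · simp only [mul_assoc, C'.mul, add_zero]
  · have h1 := hm.2.2 a ha ha'
    calc b ⟨a, ha⟩ * (b h * m * b' k) = b h * (b ⟨a, ha⟩ * m) * b' k := by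
          rw [← mul_assoc, ← mul_assoc, ← mul_assoc, C.mul, C.mul, add_comm]
      _ = χ ⟨a, ha, ha'⟩ • (b h * m * (b' ⟨a, ha'⟩ * b' k)) := by
          rw [h1, mul_smul_comm, smul_mul_assoc]; simp only [mul_assoc]
      _ = _ := by rw [C'.mul, add_comm, ← C'.mul]; simp only [mul_assoc]

theorem mul_mul_ne_zero (C : Corner 𝒜 fr S H b) (C' : Corner 𝒜 fr S' H' b') {m : A}
    (hbm : b 0 * m = m) (hmb : m * b' 0 = m) (h0 : m ≠ 0) (h : H) (k : H') :
    b h * m * b' k ≠ 0 := by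
  intro h1
  apply h0
  calc m = b (-h) * (b h * m * b' k) * b' (-k) := by
        rw [mul_assoc, mul_assoc, C'.b_mul_neg, mul_assoc, hmb, ← mul_assoc, C.b_neg_mul, hbm]
    _ = 0 := by rw [h1]; simp

/-- The difference `h - h₁ = k₁ - k` lies in both groups and can be moved across `m` at the cost of
a scalar. -/
theorem mul_mul_eq_smul (C : Corner 𝒜 fr S H b) (C' : Corner 𝒜 fr S' H' b')
    {χ : AddChar (H ⊓ H' : AddSubgroup G) F} {m : A} (hm : m ∈ weightSpace b b' χ)
    {h h₁ : H} {k k₁ : H'} (he : (h : G) + k = h₁ + k₁) :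
    ∃ r : F, b h * m * b' k = r • (b h₁ * m * b' k₁) := by
  have ha : (h : G) - h₁ = k₁ - k := by
    rw [sub_eq_sub_iff_add_eq_add, he, add_comm]
  have ha' : (h : G) - h₁ ∈ H' := ha ▸ H'.sub_mem k₁.2 k.2
  have h1 := hm.2.2 (h - h₁) (H.sub_mem h.2 h₁.2) ha'
  have h2 : b h = b h₁ * b ⟨(h : G) - h₁, H.sub_mem h.2 h₁.2⟩ := by
    rw [C.mul]; congr 1; ext; simp
  have h3 : b' k₁ = b' ⟨(h : G) - h₁, ha'⟩ * b' k := by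
    rw [C'.mul]; congr 1; ext; simp [ha]
  refine ⟨χ ⟨(h : G) - h₁, H.sub_mem h.2 h₁.2, ha'⟩, ?_⟩
  rw [h2, mul_assoc (b h₁), h1, h3, mul_smul_comm, smul_mul_assoc]
  simp only [mul_assoc]

variable [DecidableEq G] [GradedAlgebra 𝒜]

theorem proj_mem_weightSpace (C : Corner 𝒜 fr S H b) (C' : Corner 𝒜 fr S' H' b')
    {χ : AddChar (H ⊓ H' : AddSubgroup G) F} {m : A} (hm : m ∈ weightSpace b b' χ) (d : G) :
    GradedAlgebra.proj 𝒜 d m ∈ weightSpace b b' χ := by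
  refine ⟨?_, ?_, fun a h h' => ?_⟩
  · have := proj_mul_left (d := d) (m := m) (C.mem 0)
    rw [hm.1] at this
    simpa using this.symm
  · have := proj_mul_right (d := d) (m := m) (C'.mem 0)
    rw [hm.2.1] at this
    simpa using this.symm
  · rw [← proj_mul_left (C.mem _), ← proj_mul_right (C'.mem _), hm.2.2 a h h', map_smul,
      add_comm d]

theorem proj_mem_orbitSpan (C : Corner 𝒜 fr S H b) (C' : Corner 𝒜 fr S' H' b') {m : A} {d : G}
    (hd : m ∈ 𝒜 d) (g : G) {n : A} (hn : n ∈ orbitSpan F b b' m) :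
    GradedAlgebra.proj 𝒜 g n ∈ orbitSpan F b b' m := by
  suffices orbitSpan F b b' m ≤ (orbitSpan F b b' m).comap (GradedAlgebra.proj 𝒜 g) from this hn
  conv_lhs => rw [orbitSpan]
  rw [Submodule.span_le]
  rintro _ ⟨⟨h, k⟩, rfl⟩
  have hmem : b h * m * b' k ∈ 𝒜 ((h : G) + d + (k : G)) :=
    SetLike.mul_mem_graded (SetLike.mul_mem_graded (C.mem h) hd) (C'.mem k)
  change GradedAlgebra.proj 𝒜 g (b h * m * b' k) ∈ orbitSpan F b b' m
  by_cases hg : (h : G) + d + (k : G) = g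
  · subst hg
    rw [proj_same hmem]
    exact Submodule.subset_span ⟨(h, k), rfl⟩
  · rw [proj_of_ne hmem hg]
    exact zero_mem _

/-- A weight space is generated, as a bimodule, by any of its nonzero homogeneous elements. -/
theorem orbitSpan_eq_weightSpace (C : Corner 𝒜 fr S H b) (C' : Corner 𝒜 fr S' H' b')
    {χ : AddChar (H ⊓ H' : AddSubgroup G) F} {m : A} (hm : m ∈ weightSpace b b' χ) (h0 : m ≠ 0)
    {d : G} (hd : m ∈ 𝒜 d) : orbitSpan F b b' m = weightSpace b b' χ := by
  refine le_antisymm (C.orbitSpan_le_weightSpace C' hm) fun n hn => ?_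
  refine mem_of_proj_mem 𝒜 _ fun g => ?_
  have hg := C.proj_mem_weightSpace C' hn g
  have hgg := proj_mem 𝒜 g n
  set n' := GradedAlgebra.proj 𝒜 g n
  obtain ⟨x, hx, y, hy, hxy⟩ := fr.exists_mul_mul_ne_zero (C.zero ▸ hm.1) (C'.zero ▸ hm.2.1) h0
  have hχ := C.eq_pairChar C' hx hy hm hxy
  obtain ⟨r, hr0, hr⟩ := C.exists_proj_eq_smul C' hx hy hgg hg.2.1 (fun a h h' => by
    rw [hg.2.2 a h h', hχ, smul_smul]
    congr 1
    change _ * (fr.ev x (b ⟨a, h⟩) * fr.ev y (b' (-⟨a, h'⟩))) = _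
    rw [mul_left_comm, mul_comm (fr.ev y _), C'.ev_neg hy, mul_one])
  -- Thinness enters here: `ε x * n' * ε y` is a multiple of `ε x * m * ε y`, which lies in the
  -- bimodule generated by `m`.
  obtain ⟨z, hz⟩ := fr.thin x y
  obtain ⟨p, hp⟩ := hz m
  obtain ⟨q, hq⟩ := hz n'
  have hp0 : p ≠ 0 := by
    rintro rfl
    exact hxy (by rw [hp, zero_smul])
  have h1 : fr.ε x * n' * fr.ε y = (q * p⁻¹) • (fr.ε x * m * fr.ε y) := by
    rw [hp, hq, smul_smul, mul_assoc, inv_mul_cancel₀ hp0, mul_one]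
  have h2 : r • n' ∈ orbitSpan F b b' m := by
    rw [← hr, h1, map_smul]
    exact Submodule.smul_mem _ _ (C.proj_mem_orbitSpan C' hd g
      (mul_mul_mem_orbitSpan (C.ε_mem hx) (C'.ε_mem hy)))
  have h3 := Submodule.smul_mem _ r⁻¹ h2
  rwa [smul_smul, inv_mul_cancel₀ hr0, one_smul] at h3

/-- The bimodule generated by a homogeneous element of a weight space is a shifted group algebra. -/
theorem gradedIso_orbitSpan (C : Corner 𝒜 fr S H b) (C' : Corner 𝒜 fr S' H' b')
    {χ : AddChar (H ⊓ H' : AddSubgroup G) F} {m : A} (hm : m ∈ weightSpace b b' χ) (h0 : m ≠ 0)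
    {d : G} (hd : m ∈ 𝒜 d) :
    GradedIso (shift (groupAlgebraGrading F (H ⊔ H')) d)
      (restrict 𝒜 (orbitSpan F b b' m)) := by
  have hdec : ∀ g : (H ⊔ H' : AddSubgroup G), ∃ p : H × H', (p.1 : G) + p.2 = g := by
    rintro ⟨g, hg⟩
    obtain ⟨h, hh, k, hk, rfl⟩ := AddSubgroup.mem_sup.1 hg
    exact ⟨(⟨h, hh⟩, ⟨k, hk⟩), rfl⟩
  choose p hp using hdec
  -- One product for each element of `H ⊔ H'`: these have distinct degrees, and any other
  -- factorization changes the product by a scalar only, so they form a homogeneous basis.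
  let v : (H ⊔ H' : AddSubgroup G) → orbitSpan F b b' m := fun g =>
    ⟨b (p g).1 * m * b' (p g).2, Submodule.subset_span ⟨p g, rfl⟩⟩
  have hvmem : ∀ g : (H ⊔ H' : AddSubgroup G), (v g : A) ∈ 𝒜 (d + (g : G)) := by
    intro g
    have h1 := SetLike.mul_mem_graded (SetLike.mul_mem_graded (C.mem (p g).1) hd) (C'.mem (p g).2)
    have h2 : ((p g).1 : G) + d + (p g).2 = d + g := by rw [← hp g]; abel
    rwa [h2] at h1
  have hv0 : ∀ g, (v g : A) ≠ 0 := fun g => C.mul_mul_ne_zero C' hm.1 hm.2.1 h0 _ _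
  have hli : LinearIndependent F v := by
    apply LinearIndependent.of_comp (orbitSpan F b b' m).subtype
    exact linearIndependent_of_mem (𝒜 := 𝒜)
      (δ := fun g : (H ⊔ H' : AddSubgroup G) => d + (g : G))
      (fun g g' h => Subtype.ext (add_left_cancel h)) hvmem hv0
  have hsp : ⊤ ≤ Submodule.span F (Set.range v) := by
    have h1 : orbitSpan F b b' m ≤
        (Submodule.span F (Set.range v)).map (orbitSpan F b b' m).subtype := by
      conv_lhs => rw [orbitSpan]
      rw [Submodule.span_le]
      rintro _ ⟨⟨h, k⟩, rfl⟩
      let g : (H ⊔ H' : AddSubgroup G) := ⟨(h : G) + k, AddSubgroup.add_mem_sup h.2 k.2⟩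
      obtain ⟨r, hr⟩ := C.mul_mul_eq_smul C' hm (h := h) (k := k) (h₁ := (p g).1) (k₁ := (p g).2)
        (hp g).symm
      refine ⟨r • v g, Submodule.smul_mem _ _ (Submodule.subset_span ⟨g, rfl⟩), ?_⟩
      exact hr.symm
    rintro ⟨n, hn⟩ -
    obtain ⟨n', hn', he⟩ := h1 hn
    have : n' = ⟨n, hn⟩ := Subtype.ext he
    rwa [← this]
  let B := Module.Basis.mk hli hsp
  refine ⟨(AddMonoidAlgebra.coeffLinearEquiv F).trans B.repr.symm, fun g => ?_⟩
  have happ : ∀ f : AddMonoidAlgebra F (H ⊔ H' : AddSubgroup G),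
      (((AddMonoidAlgebra.coeffLinearEquiv F).trans B.repr.symm f :
        orbitSpan F b b' m) : A) = ∑ k ∈ f.coeff.support, f.coeff k • (v k : A) := by
    intro f
    rw [LinearEquiv.trans_apply, Module.Basis.repr_symm_apply, Finsupp.linearCombination_apply,
      Finsupp.sum, Submodule.coe_sum]
    refine Finset.sum_congr rfl fun k _ => ?_
    simp only [B, Module.Basis.mk_apply, Submodule.coe_smul]
    rfl
  ext n
  constructor
  · rintro ⟨f, hf, rfl⟩
    change (((AddMonoidAlgebra.coeffLinearEquiv F).trans B.repr.symm f :
        orbitSpan F b b' m) : A) ∈ 𝒜 g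
    rw [happ]
    refine Submodule.sum_mem _ fun k hk => Submodule.smul_mem _ _ ?_
    have h1 : (k : G) = -d + g := hf k hk
    have h2 := hvmem k
    rwa [h1, add_neg_cancel_left] at h2
  · intro hn
    obtain ⟨f, rfl⟩ := ((AddMonoidAlgebra.coeffLinearEquiv F).trans B.repr.symm).surjective n
    refine ⟨f, fun k hk => ?_, rfl⟩
    by_contra hne
    have hn' : (((AddMonoidAlgebra.coeffLinearEquiv F).trans B.repr.symm f :
        orbitSpan F b b' m) : A) ∈ 𝒜 g := hn
    rw [happ] at hn'
    have hkg : g ≠ d + (k : G) := by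
      rintro rfl
      exact hne (by simp)
    have h1 := proj_of_ne hn' hkg
    rw [map_sum, Finset.sum_eq_single k] at h1
    · rw [map_smul, proj_same (hvmem k), smul_eq_zero] at h1
      exact h1.elim (Finsupp.mem_support_iff.1 hk) (hv0 k)
    · intro k' _ hk'
      rw [map_smul, proj_of_ne (hvmem k'), smul_zero]
      intro h2
      exact hk' (Subtype.ext (add_left_cancel h2))
    · exact fun h => absurd hk h

end Corner

theorem linearIndependent_addChar (K F : Type*) [AddCommGroup K] [Field F] :
    LinearIndependent F fun χ : AddChar K F => (χ : K → F) := by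
  have h := linearIndependent_monoidHom (Multiplicative K) F
  exact h.comp (fun χ : AddChar K F => χ.toMonoidHom)
    (fun χ ψ hχ => AddChar.toMonoidHomEquiv.injective hχ)

theorem finite_addChar (K F : Type*) [AddCommGroup K] [Finite K] [Field F] :
    Finite (AddChar K F) := by
  have := Fintype.ofFinite K
  exact (linearIndependent_addChar K F).finite

theorem card_addChar_le (K F : Type*) [AddCommGroup K] [Finite K] [Field F] :
    Nat.card (AddChar K F) ≤ Nat.card K := by
  have := Fintype.ofFinite K
  have := finite_addChar K F
  have := Fintype.ofFinite (AddChar K F)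
  have h := (linearIndependent_addChar K F).fintype_card_le_finrank
  rw [Module.finrank_fintype_fun_eq_card] at h
  rwa [Nat.card_eq_fintype_card, Nat.card_eq_fintype_card]

end Weight

/-! ### Off-diagonal blocks of a triangular form -/

section Form

variable {F A X G : Type*} [Field F] [Ring A] [Algebra F A] [PartialOrder X] [Fintype X]
  [AddCommGroup G] {𝒜 : G → Submodule F A}

namespace TriangularForm

variable {t : ℕ} (D : TriangularForm 𝒜 t)

theorem elt_zero (i : Fin t) : D.elt i 0 = D.ι i 1 := rfl

theorem ι_mem_span (i : Fin t) (a : AddMonoidAlgebra F (D.H i)) :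
    D.ι i a ∈ Submodule.span F (Set.range (D.elt i)) := by
  induction a using AddMonoidAlgebra.induction_on with
  | of h => exact Submodule.subset_span ⟨h, rfl⟩
  | add x y hx hy => rw [map_add]; exact add_mem hx hy
  | smul r x hx => rw [map_smul]; exact Submodule.smul_mem _ _ hx

theorem corner (fr : Frame F A X) {S : Finset X} {i : Fin t} (hS : D.ι i 1 = ∑ x ∈ S, fr.ε x) :
    Corner 𝒜 fr S (D.H i) (D.elt i) where
  finite := D.finite i
  mem := D.graded i
  mul h k := by
    rw [elt, elt, elt, ← map_mul, AddMonoidAlgebra.single_mul_single, mul_one]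
  zero := hS
  ne_zero := by
    rw [D.elt_zero, Ne, ← map_zero (D.ι i), (D.injective i).eq_iff]
    exact one_ne_zero
  span a := by
    obtain ⟨c, hc⟩ := D.surjective i a
    rw [D.elt_zero, ← hc]
    exact D.ι_mem_span i c

theorem cyclic_eq_orbitSpan (i j : Fin t) (m : A) :
    D.cyclic i j m = orbitSpan F (D.elt i) (D.elt j) m := by
  apply le_antisymm
  · rw [cyclic, Submodule.span_le]
    rintro _ ⟨a, a', rfl⟩
    exact mul_mul_mem_orbitSpan (D.ι_mem_span i a) (D.ι_mem_span j a')
  · rw [orbitSpan, Submodule.span_le]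
    rintro _ ⟨⟨h, k⟩, rfl⟩
    exact Submodule.subset_span ⟨_, _, rfl⟩

theorem mem_block_iff {i j : Fin t} {m : A} :
    m ∈ D.block i j ↔ D.elt i 0 * m = m ∧ m * D.elt j 0 = m := by
  rw [D.elt_zero, D.elt_zero]
  constructor
  · rintro ⟨a, rfl⟩
    rw [LinearMap.mulLeftRight_apply]
    refine ⟨?_, ?_⟩
    · rw [← mul_assoc, ← mul_assoc, (D.idem.idem i).eq]
    · rw [mul_assoc, (D.idem.idem j).eq]
  · rintro ⟨h1, h2⟩
    exact ⟨m, by rw [LinearMap.mulLeftRight_apply, h1, h2]⟩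

/-- The structure of the off-diagonal blocks of a triangular form. -/
theorem exists_decomposition [DecidableEq G] [GradedAlgebra 𝒜] (fr₀ : Frame F A X) (i j : Fin t) :
    ∃ (s : ℕ) (χ : Fin s → AddChar (D.H i ⊓ D.H j : AddSubgroup G) F)
      (m : Fin s → A) (d : Fin s → G),
      Function.Injective χ ∧
      (∀ l, m l ∈ D.block i j ∧ m l ≠ 0 ∧ m l ∈ 𝒜 (d l)) ∧
      iSupIndep (fun l => D.cyclic i j (m l)) ∧
      (⨆ l, D.cyclic i j (m l)) = D.block i j ∧
      (∀ l (h : G) (hi : h ∈ D.H i) (hj : h ∈ D.H j),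
        D.elt i ⟨h, hi⟩ * m l = χ l ⟨h, hi, hj⟩ • (m l * D.elt j ⟨h, hj⟩)) ∧
      (∀ l, GradedIso (shift (groupAlgebraGrading F (D.H i ⊔ D.H j)) (d l))
        (restrict 𝒜 (D.cyclic i j (m l)))) ∧
      s ≤ Nat.card (D.H i ⊓ D.H j : AddSubgroup G) := by
  classical
  obtain ⟨fr, c, hc⟩ := fr₀.exists_adapted D.idem
  have C := D.corner fr (hc i)
  have C' := D.corner fr (hc j)
  have := D.finite i
  have : Finite (D.H i ⊓ D.H j : AddSubgroup G) :=
    Finite.of_injective _ (AddSubgroup.inclusion_injective (inf_le_left : D.H i ⊓ D.H j ≤ D.H i))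
  have := finite_addChar (D.H i ⊓ D.H j : AddSubgroup G) F
  let W := fun χ : AddChar (D.H i ⊓ D.H j : AddSubgroup G) F =>
    weightSpace (D.elt i) (D.elt j) χ
  -- The weights that occur index the summands; any nonzero homogeneous component of a weight vector
  -- serves as generator.
  let T := {χ // W χ ≠ ⊥}
  let eqv : T ≃ Fin (Nat.card T) := Finite.equivFin T
  have hex : ∀ χ : T, ∃ m : A, ∃ d : G, m ∈ W χ ∧ m ≠ 0 ∧ m ∈ 𝒜 d := by
    rintro ⟨χ, hχ⟩
    obtain ⟨w, hw, hw0⟩ := Submodule.exists_mem_ne_zero_of_ne_bot hχ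
    obtain ⟨d, hd⟩ := exists_proj_ne_zero 𝒜 hw0
    exact ⟨_, d, C.proj_mem_weightSpace C' hw d, hd, proj_mem 𝒜 d w⟩
  choose m d hm hm0 hmd using hex
  have hcyc : ∀ χ : T, D.cyclic i j (m χ) = W χ := fun χ => by
    rw [D.cyclic_eq_orbitSpan, C.orbitSpan_eq_weightSpace C' (hm χ) (hm0 χ) (hmd χ)]
  refine ⟨Nat.card T, fun l => (eqv.symm l).1, fun l => m (eqv.symm l), fun l => d (eqv.symm l),
    Subtype.val_injective.comp eqv.symm.injective, fun l => ⟨?_, hm0 _, hmd _⟩, ?_, ?_, ?_, ?_, ?_⟩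
  · exact D.mem_block_iff.2 ⟨(hm _).1, (hm _).2.1⟩
  · simp only [hcyc]
    exact (C.iSupIndep_weightSpace C').comp (Subtype.val_injective.comp eqv.symm.injective)
  · simp only [hcyc]
    apply le_antisymm
    · exact iSup_le fun l n hn => D.mem_block_iff.2 ⟨hn.1, hn.2.1⟩
    · intro n hn
      obtain ⟨h1, h2⟩ := D.mem_block_iff.1 hn
      refine (iSup_le fun χ => ?_ : (⨆ χ, W χ) ≤ _) (C.mem_iSup_weightSpace C' h1 h2)
      by_cases hχ : W χ = ⊥
      · rw [hχ]; exact bot_le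
      · refine le_trans (le_of_eq ?_) (le_iSup _ (eqv ⟨χ, hχ⟩))
        simp
  · exact fun l h hi hj => (hm _).2.2 h hi hj
  · intro l
    rw [D.cyclic_eq_orbitSpan]
    exact C.gradedIso_orbitSpan C' (hm _) (hm0 _) (hmd _)
  · exact (Nat.card_le_card_of_injective _ Subtype.val_injective).trans (card_addChar_le _ F)

end TriangularForm

end Form

end GradedIncidence

namespace GradedIncidence

/-! ### Characters of the algebra and homogeneous elements -/

section Commutator

variable {F A G : Type*} [Field F] [Ring A] [Algebra F A] [AddCommGroup G] [DecidableEq G]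
  (𝒜 : G → Submodule F A) [GradedAlgebra 𝒜]

/-- A character of a graded algebra vanishes on the homogeneous components of commutators. -/
theorem map_proj_commutator (φ : A →ₐ[F] F) (g : G) (a a' : A) :
    φ (GradedAlgebra.proj 𝒜 g (a * a' - a' * a)) = 0 := by
  let N : Submodule F A := LinearMap.ker (φ.toLinearMap ∘ₗ GradedAlgebra.proj 𝒜 g)
  have hN : ∀ z, z ∈ N ↔ φ (GradedAlgebra.proj 𝒜 g z) = 0 := fun z => Iff.rfl
  rw [← hN]
  -- As `G` is abelian, the commutator of homogeneous elements is homogeneous, so its component is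
  -- either itself or zero; the general case follows by linearity in each argument.
  have h1 : ∀ k l, ∀ u ∈ 𝒜 k, ∀ w ∈ 𝒜 l, u * w - w * u ∈ N := by
    intro k l u hu w hw
    have h2 : u * w - w * u ∈ 𝒜 (k + l) := by
      refine sub_mem (SetLike.mul_mem_graded hu hw) ?_
      rw [add_comm]
      exact SetLike.mul_mem_graded hw hu
    rw [hN]
    by_cases hg : k + l = g
    · subst hg
      rw [proj_same h2, map_sub, map_mul, map_mul, mul_comm, sub_self]
    · rw [proj_of_ne h2 hg, map_zero]
  have h3 : ∀ k, ∀ u ∈ 𝒜 k, ∀ w, u * w - w * u ∈ N := by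
    intro k u hu w
    let L : A →ₗ[F] A := LinearMap.mulLeft F u - LinearMap.mulRight F u
    exact mem_of_proj_mem 𝒜 (N.comap L) fun l => h1 k l u hu _ (proj_mem 𝒜 l w)
  let L : A →ₗ[F] A := LinearMap.mulRight F a' - LinearMap.mulLeft F a'
  exact mem_of_proj_mem 𝒜 (N.comap L) fun k => h3 k _ (proj_mem 𝒜 k a) a'

theorem finite_support [FiniteDimensional F A] : {g | 𝒜 g ≠ ⊥}.Finite :=
  WellFoundedGT.finite_ne_bot_of_iSupIndep (iSupIndep_grading 𝒜)

variable {𝒜}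

theorem aeval_mem_zero {a : A} (ha : a ∈ 𝒜 0) (p : Polynomial F) :
    Polynomial.aeval a p ∈ 𝒜 0 := by
  induction p using Polynomial.induction_on' with
  | add p q hp hq => rw [map_add]; exact add_mem hp hq
  | monomial n r =>
    rw [Polynomial.aeval_monomial, ← Algebra.smul_def]
    refine Submodule.smul_mem _ _ ?_
    have := SetLike.pow_mem_graded n ha
    rwa [smul_zero] at this

/-- A homogeneous element on which some character does not vanish has a degree of finite order. -/
theorem exists_nsmul_eq_zero [FiniteDimensional F A] {g : G} {a : A} (ha : a ∈ 𝒜 g)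
    {φ : A →ₐ[F] F} (h0 : φ a ≠ 0) : ∃ n : ℕ, (n + 1) • g = 0 := by
  have hfin := finite_support 𝒜
  have hmem : ∀ n : ℕ, n • g ∈ {g | 𝒜 g ≠ ⊥} := by
    intro n hbot
    have h1 : a ^ n ∈ 𝒜 (n • g) := SetLike.pow_mem_graded n ha
    rw [hbot, Submodule.mem_bot] at h1
    have h2 := congrArg φ h1
    rw [map_pow, map_zero] at h2
    exact h0 (eq_zero_of_pow_eq_zero h2)
  -- All powers of `a` are nonzero, while only finitely many degrees occur, so two multiples of `g`
  -- coincide.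
  obtain ⟨m, -, n, -, hmn, he⟩ := Set.infinite_univ.exists_lt_map_eq_of_mapsTo
    (fun n _ => hmem n) hfin
  refine ⟨n - m - 1, ?_⟩
  have h3 : n - m - 1 + 1 = n - m := by omega
  rw [h3]
  have h4 : m • g + (n - m) • g = m • g + 0 := by
    rw [← add_nsmul, add_zero, he]; congr 1; omega
  exact add_left_cancel h4

end Commutator

/-! ### Corners of primitive idempotents of degree zero -/

section LocalCorner

variable {F A X G : Type*} [Field F] [Ring A] [Algebra F A] [PartialOrder X] [Fintype X]
  [AddCommGroup G]

/-- `a` lies in the corner of `A` cut out by the idempotents in `S`. -/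
structure InCorner (fr : Frame F A X) (S : Finset X) (a : A) : Prop where
  left : (∑ x ∈ S, fr.ε x) * a = a
  right : a * (∑ x ∈ S, fr.ε x) = a

namespace InCorner

variable {fr : Frame F A X} {S : Finset X} {a a' : A}

theorem mul (h : InCorner fr S a) (h' : InCorner fr S a') : InCorner fr S (a * a') :=
  ⟨by rw [← mul_assoc, h.left], by rw [mul_assoc, h'.right]⟩

theorem sub (h : InCorner fr S a) (h' : InCorner fr S a') : InCorner fr S (a - a') :=
  ⟨by rw [mul_sub, h.left, h'.left], by rw [sub_mul, h.right, h'.right]⟩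

theorem smul (r : F) (h : InCorner fr S a) : InCorner fr S (r • a) :=
  ⟨by rw [mul_smul_comm, h.left], by rw [smul_mul_assoc, h.right]⟩

theorem unit : InCorner fr S (∑ x ∈ S, fr.ε x) :=
  ⟨fr.complete.isIdempotentElem_sum.eq, fr.complete.isIdempotentElem_sum.eq⟩

theorem ε {x : X} (hx : x ∈ S) : InCorner fr S (fr.ε x) :=
  ⟨fr.sum_mul_ε hx, fr.ε_mul_sum hx⟩

theorem ε_mul_ε {x y : X} (hx : x ∈ S) (hy : y ∈ S) (a : A) :
    InCorner fr S (fr.ε x * a * fr.ε y) :=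
  ⟨by rw [← mul_assoc, ← mul_assoc, fr.sum_mul_ε hx], by rw [mul_assoc, fr.ε_mul_sum hy]⟩

theorem pow (h : InCorner fr S a) (n : ℕ) : InCorner fr S (a ^ (n + 1)) := by
  induction n with
  | zero => simpa using h
  | succ n ih => rw [pow_succ]; exact ih.mul h

theorem proj [DecidableEq G] {𝒜 : G → Submodule F A} [GradedAlgebra 𝒜]
    (he : ∑ x ∈ S, fr.ε x ∈ 𝒜 0) (h : InCorner fr S a) (g : G) :
    InCorner fr S (GradedAlgebra.proj 𝒜 g a) := by
  constructor
  · have := proj_mul_left (d := g) (m := a) he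
    rw [h.left, zero_add] at this
    exact this.symm
  · have := proj_mul_right (d := g) (m := a) he
    rw [h.right, add_zero] at this
    exact this.symm

theorem eq_zero (h : InCorner fr S a) (h0 : ∀ x ∈ S, ∀ y ∈ S, fr.ε x * a * fr.ε y = 0) :
    a = 0 := by
  by_contra hne
  obtain ⟨x, hx, y, hy, hxy⟩ := fr.exists_mul_mul_ne_zero h.left h.right hne
  exact hxy (h0 x hx y hy)

/-- The homogeneous components of an element of the radical of the corner are in the radical. -/
theorem ev_proj_eq_zero [DecidableEq G] (𝒜 : G → Submodule F A) [GradedAlgebra 𝒜]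
    (hc : InCorner fr S a) (h0 : ∀ x ∈ S, fr.ev x a = 0) (g : G) (z : X) : fr.ev z
    (GradedAlgebra.proj 𝒜 g a) = 0 := by
  have h1 : a = ∑ y ∈ S, ∑ x ∈ S, fr.ε x * a * fr.ε y := by
    conv_lhs => rw [← hc.right, ← hc.left, Finset.sum_mul, Finset.mul_sum]
    exact Finset.sum_congr rfl fun y _ => Finset.sum_mul _ _ _
  rw [h1, map_sum, map_sum]
  refine Finset.sum_eq_zero fun y hy => ?_
  rw [map_sum, map_sum]
  refine Finset.sum_eq_zero fun x hx => ?_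
  by_cases hxy : x = y
  · subst hxy
    rw [fr.diag, h0 x hx, zero_smul, map_zero, map_zero]
  · have h2 : fr.ε x * a * fr.ε y =
        fr.ε x * (fr.ε x * a * fr.ε y) - (fr.ε x * a * fr.ε y) * fr.ε x := by
      rw [mul_assoc _ _ (fr.ε x), fr.complete.ortho (Ne.symm hxy), mul_zero, sub_zero, ← mul_assoc,
        ← mul_assoc, (fr.complete.idem x).eq]
    rw [h2]
    exact map_proj_commutator 𝒜 (fr.ev z) g _ _

end InCorner

/-- The sum of the idempotents in `S` is a primitive idempotent of the component of degree `0`. -/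
structure LocalCorner (𝒜 : G → Submodule F A) (fr : Frame F A X) (S : Finset X) : Prop where
  nonempty : S.Nonempty
  mem : ∑ x ∈ S, fr.ε x ∈ 𝒜 0
  primitive : ∀ f ∈ 𝒜 0, IsIdempotentElem f → InCorner fr S f → f = 0 ∨ f = ∑ x ∈ S, fr.ε x

namespace LocalCorner

variable [DecidableEq G] {𝒜 : G → Submodule F A} [GradedAlgebra 𝒜] {fr : Frame F A X}
  {S : Finset X}

/-- Two different diagonal values, one of them nonzero, would be separated by a polynomial in `a`
that is a proper idempotent of degree `0` in the corner. -/
theorem ev_eq_of_ne_zero (L : LocalCorner 𝒜 fr S) {a : A} (ha : a ∈ 𝒜 0) (hc : InCorner fr S a)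
    {x y : X}
    (hy : y ∈ S) (h0 : fr.ev x a ≠ 0) : fr.ev x a = fr.ev y a := by
  classical
  by_contra hne
  set α := fr.ev x a with hα
  let V : Finset F := (Finset.univ.image fun z => fr.ev z a).erase α
  let p₀ : Polynomial F := Polynomial.X * ∏ v ∈ V, (Polynomial.X - Polynomial.C v)
  have hp₀α : p₀.eval α ≠ 0 := by
    simp only [p₀, Polynomial.eval_mul, Polynomial.eval_X, Polynomial.eval_prod,
      Polynomial.eval_sub, Polynomial.eval_C]
    refine mul_ne_zero h0 (Finset.prod_ne_zero_iff.2 fun v hv => ?_)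
    rw [sub_ne_zero]
    exact (Finset.ne_of_mem_erase hv).symm
  have hp₀v : ∀ z, fr.ev z a ≠ α → p₀.eval (fr.ev z a) = 0 := by
    intro z hz
    simp only [p₀, Polynomial.eval_mul, Polynomial.eval_X, Polynomial.eval_prod,
      Polynomial.eval_sub, Polynomial.eval_C]
    rw [Finset.prod_eq_zero (i := fr.ev z a), mul_zero]
    · exact Finset.mem_erase.2 ⟨hz, Finset.mem_image.2 ⟨z, Finset.mem_univ _, rfl⟩⟩
    · exact sub_self _
  let p : Polynomial F := Polynomial.C (p₀.eval α)⁻¹ * p₀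
  have hpα : p.eval α = 1 := by
    simp only [p, Polynomial.eval_mul, Polynomial.eval_C]
    exact inv_mul_cancel₀ hp₀α
  have hpv : ∀ z, fr.ev z a ≠ α → p.eval (fr.ev z a) = 0 := by
    intro z hz
    simp only [p, Polynomial.eval_mul, hp₀v z hz, mul_zero]
  have hp0 : p.eval 0 = 0 := by simp [p, p₀]
  have hev : ∀ (z : X) (q : Polynomial F), fr.ev z (Polynomial.aeval a q) = q.eval (fr.ev z a) := by
    intro z q
    rw [← Polynomial.aeval_algHom_apply, Polynomial.coe_aeval_eq_eval]
  have hnil : IsNilpotent (Polynomial.aeval a p - Polynomial.aeval a p ^ 2) := by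
    refine fr.nilpotent _ fun z => ?_
    rw [map_sub, map_pow, hev]
    by_cases hz : fr.ev z a = α
    · rw [hz, hpα]; ring
    · rw [hpv z hz]; ring
  obtain ⟨n, hn⟩ := hnil
  -- Lifts `p(a)`, idempotent up to a nilpotent, to an idempotent. The exponent `n + 1` is positive,
  -- so that `P` is `1` where `p` is `1` and vanishes where `p` does; having no constant term,
  -- `P(a)` stays in the corner.
  have hn' := isIdempotentElem_one_sub_one_sub_pow_pow _ (n + 1)
    (by rw [pow_succ, hn, zero_mul] :
      (Polynomial.aeval a p - Polynomial.aeval a p ^ 2) ^ (n + 1) = 0)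
  let P : Polynomial F := 1 - (1 - p ^ (n + 1)) ^ (n + 1)
  have hP : Polynomial.aeval a P =
      1 - (1 - Polynomial.aeval a p ^ (n + 1)) ^ (n + 1) := by simp [P]
  rw [← hP] at hn'
  obtain ⟨Q, hQ⟩ : Polynomial.X ∣ P := by
    rw [Polynomial.X_dvd_iff, Polynomial.coeff_zero_eq_eval_zero]
    simp [P, hp0]
  have hPc : InCorner fr S (Polynomial.aeval a P) := by
    constructor
    · rw [hQ, map_mul, Polynomial.aeval_X, ← mul_assoc, hc.left]
    · rw [hQ, mul_comm, map_mul, Polynomial.aeval_X, mul_assoc, hc.right]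
  have hPx : fr.ev x (Polynomial.aeval a P) = 1 := by
    rw [hev]
    simp [P, ← hα, hpα]
  have hPy : fr.ev y (Polynomial.aeval a P) = 0 := by
    rw [hev]
    simp [P, hpv y (Ne.symm hne)]
  rcases L.primitive _ (aeval_mem_zero ha P) hn' hPc with h | h
  · rw [h, map_zero] at hPx
    exact zero_ne_one hPx
  · rw [h, fr.ev_sum hy] at hPy
    exact one_ne_zero hPy

theorem ev_eq (L : LocalCorner 𝒜 fr S) {a : A} (ha : a ∈ 𝒜 0) (hc : InCorner fr S a) {x y : X}
    (hx : x ∈ S)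
    (hy : y ∈ S) : fr.ev x a = fr.ev y a := by
  by_cases h0 : fr.ev x a = 0
  · by_cases h1 : fr.ev y a = 0
    · rw [h0, h1]
    · exact (L.ev_eq_of_ne_zero ha hc hx h1).symm
  · exact L.ev_eq_of_ne_zero ha hc hy h0

/-- A suitable positive power of `a` has degree `0`, hence constant diagonal. -/
theorem ev_ne_zero (L : LocalCorner 𝒜 fr S) [FiniteDimensional F A] {g : G} {a : A} (ha : a ∈ 𝒜 g)
    (hc : InCorner fr S a)
    {x y : X} (hx : x ∈ S) (hy : y ∈ S) (h0 : fr.ev x a ≠ 0) : fr.ev y a ≠ 0 := by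
  obtain ⟨n, hn⟩ := exists_nsmul_eq_zero ha h0
  have h1 : a ^ (n + 1) ∈ 𝒜 0 := hn ▸ SetLike.pow_mem_graded (n + 1) ha
  have h2 := L.ev_eq h1 (hc.pow n) hx hy
  rw [map_pow, map_pow] at h2
  intro h3
  rw [h3, zero_pow (Nat.succ_ne_zero n)] at h2
  exact pow_ne_zero _ h0 h2

/-- The degrees of the homogeneous elements of the corner that are not in the radical. -/
def degreeGroup (L : LocalCorner 𝒜 fr S) [FiniteDimensional F A] : AddSubgroup G where
  carrier := {g | ∃ a ∈ 𝒜 g, InCorner fr S a ∧ ∀ x ∈ S, fr.ev x a ≠ 0}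
  zero_mem' := ⟨_, L.mem, InCorner.unit, fun x hx => by rw [fr.ev_sum hx]; exact one_ne_zero⟩
  add_mem' := by
    rintro g g' ⟨a, ha, hc, h0⟩ ⟨a', ha', hc', h0'⟩
    exact ⟨a * a', SetLike.mul_mem_graded ha ha', hc.mul hc', fun x hx => by
      rw [map_mul]; exact mul_ne_zero (h0 x hx) (h0' x hx)⟩
  neg_mem' := by
    rintro g ⟨a, ha, hc, h0⟩
    obtain ⟨x, hx⟩ := L.nonempty
    obtain ⟨n, hn⟩ := exists_nsmul_eq_zero ha (h0 x hx)
    -- `n` may be `0`, and `a ^ 0` need not lie in the corner; the exponent `2 * n + 1` is positive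
    -- and also gives degree `-g`.
    refine ⟨a ^ (2 * n + 1), ?_, hc.pow _, fun x hx => by
      rw [map_pow]; exact pow_ne_zero _ (h0 x hx)⟩
    have h1 : (2 * n + 1) • g = -g := by
      rw [eq_neg_iff_add_eq_zero, ← succ_nsmul]
      have : 2 * n + 1 + 1 = 2 * (n + 1) := by ring
      rw [this, mul_nsmul', hn, nsmul_zero]
    rw [← h1]
    exact SetLike.pow_mem_graded _ ha

variable [FiniteDimensional F A]

theorem ev_eq_zero_of_notMem (L : LocalCorner 𝒜 fr S) {g : G} (hg : g ∉ L.degreeGroup) {a : A}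
    (ha : a ∈ 𝒜 g)
    (hc : InCorner fr S a) {x : X} (hx : x ∈ S) : fr.ev x a = 0 := by
  by_contra h0
  exact hg ⟨a, ha, hc, fun y hy => L.ev_ne_zero ha hc hx hy h0⟩

/-- Otherwise every component of `ε z` would vanish at `z`. For `g` in the degree group, take `a` of
degree `-g` with nonzero diagonal: `a * ε z - ev z a • ε z` has zero diagonal on `S`, hence so has
its component of degree `0`, which ties the component of `ε z` in degree `g` to the one in degree
`0`. -/
theorem ev_proj_zero_ne_zero (L : LocalCorner 𝒜 fr S) {z x : X} (hz : z ∈ S) (hx : x ∈ S) :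
    fr.ev x (GradedAlgebra.proj 𝒜 0 (fr.ε z)) ≠ 0 := by
  intro h0
  have hcz := InCorner.ε (fr := fr) hz
  have hall : ∀ y ∈ S, fr.ev y (GradedAlgebra.proj 𝒜 0 (fr.ε z)) = 0 := fun y hy => by
    rw [← L.ev_eq (proj_mem 𝒜 0 _) (hcz.proj L.mem 0) hx hy, h0]
  have h1 : ∀ g, fr.ev z (GradedAlgebra.proj 𝒜 g (fr.ε z)) = 0 := by
    intro g
    by_cases hg : g ∈ L.degreeGroup
    · obtain ⟨a, ha, hc, ha0⟩ := L.degreeGroup.neg_mem hg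
      have h2 := ((hc.mul hcz).sub (hcz.smul (fr.ev z a))).ev_proj_eq_zero 𝒜 (fun y hy => by
          rw [map_sub, map_mul, map_smul]
          by_cases hyz : y = z
          · subst hyz
            rw [smul_eq_mul, sub_self]
          · rw [fr.ev_of_ne hyz, mul_zero, smul_zero, sub_zero]) (-g + g) z
      rw [map_sub, proj_mul_left ha, map_smul, neg_add_cancel, map_sub, map_mul, map_smul,
        hall z hz, smul_zero, sub_zero] at h2
      exact (mul_eq_zero.1 h2).resolve_left (ha0 z hz)
    · exact L.ev_eq_zero_of_notMem hg (proj_mem 𝒜 g _) (hcz.proj L.mem g) hz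
  have h2 : fr.ε z ∈ LinearMap.ker (fr.ev z).toLinearMap := mem_of_proj_mem 𝒜 _ h1
  have h3 : fr.ev z (fr.ε z) = 0 := h2
  rw [fr.ev_self] at h3
  exact one_ne_zero h3

/-- The radical of the corner is zero. -/
theorem offDiag_eq_zero (L : LocalCorner 𝒜 fr S) {x y : X} (hx : x ∈ S) (hy : y ∈ S) (hxy : x ≠ y)
    (a : A) :
    fr.ε x * a * fr.ε y = 0 := by
  classical
  by_contra hne
  -- At a minimal row `p` carrying radical, `j * ε p = 0` for every radical `j`, so the radical
  -- annihilates `w` from the left. The component `m` of `w` is then annihilated by the radical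
  -- elements of degree `0`.
  let T := S.filter fun x => ∃ y ∈ S, x ≠ y ∧ ∃ a, fr.ε x * a * fr.ε y ≠ 0
  have hT : T.Nonempty := ⟨x, Finset.mem_filter.2 ⟨hx, y, hy, hxy, a, hne⟩⟩
  obtain ⟨p, hpT, hpmin⟩ := T.exists_minimal hT
  obtain ⟨hp, q, hq, hpq, u, hu⟩ := Finset.mem_filter.1 hpT
  set w := fr.ε p * u * fr.ε q with hw
  have hwc : InCorner fr S w := InCorner.ε_mul_ε hp hq u
  have hw0 : ∀ z ∈ S, fr.ev z w = 0 := by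
    intro z _
    rw [hw, map_mul, map_mul]
    by_cases hz : z = p
    · rw [fr.ev_of_ne (show z ≠ q from hz ▸ hpq), mul_zero]
    · rw [fr.ev_of_ne hz, zero_mul, zero_mul]
  have hjw : ∀ j, InCorner fr S j → (∀ z ∈ S, fr.ev z j = 0) → j * w = 0 := by
    intro j hj hj0
    have h1 : j * fr.ε p = 0 := by
      rw [← hj.left, Finset.sum_mul, Finset.sum_mul]
      refine Finset.sum_eq_zero fun z hz => ?_
      by_cases hzp : z = p
      · rw [hzp, fr.diag, hj0 p hp, zero_smul]
      · by_contra hne'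
        have hle := fr.le_of_ne _ _ _ hne'
        have hzT : z ∈ T := Finset.mem_filter.2 ⟨hz, p, hp, hzp, j, hne'⟩
        exact hzp (le_antisymm hle (hpmin hzT hle))
    rw [hw, ← mul_assoc, ← mul_assoc, h1, zero_mul, zero_mul]
  obtain ⟨d, hd⟩ := exists_proj_ne_zero 𝒜 hu
  set m := GradedAlgebra.proj 𝒜 d w with hm
  have hmc : InCorner fr S m := hwc.proj L.mem d
  have hm0 : ∀ z ∈ S, fr.ev z m = 0 := fun z _ => hwc.ev_proj_eq_zero 𝒜 hw0 d z
  have hjm : ∀ j, InCorner fr S j → (∀ z ∈ S, fr.ev z j = 0) → j ∈ 𝒜 0 → j * m = 0 := by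
    intro j hj hj0 hjg
    rw [hm, ← proj_mul_left hjg, hjw j hj hj0, map_zero]
  -- The component of degree `0` of `ε z` is a nonzero scalar `c` modulo the radical, so it acts on
  -- `m` as `c` and `ε z * m ≠ 0`. As `m` has zero diagonal, this row reaches some `z' > z`; that is
  -- impossible at a maximal `z`.
  have hup : ∀ z ∈ S, ∃ z' ∈ S, z < z' := by
    intro z hz
    set c := fr.ev z (GradedAlgebra.proj 𝒜 0 (fr.ε z)) with hcdef
    have hc0 : c ≠ 0 := L.ev_proj_zero_ne_zero hz hz
    have hcz := InCorner.ε (fr := fr) hz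
    have h1 : (GradedAlgebra.proj 𝒜 0 (fr.ε z) - c • ∑ x ∈ S, fr.ε x) * m = 0 := by
      refine hjm _ ((hcz.proj L.mem 0).sub (InCorner.unit.smul c)) (fun y hy => ?_)
        (sub_mem (proj_mem 𝒜 0 _) (Submodule.smul_mem _ _ L.mem))
      rw [map_sub, map_smul, fr.ev_sum hy, hcdef,
        L.ev_eq (proj_mem 𝒜 0 _) (hcz.proj L.mem 0) hz hy, smul_eq_mul, mul_one, sub_self]
    rw [sub_mul, smul_mul_assoc, hmc.left, sub_eq_zero] at h1
    have h2 : fr.ε z * m ≠ 0 := by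
      intro h3
      have h4 := proj_mul_right (d := 0) (m := fr.ε z) (proj_mem 𝒜 d w)
      rw [← hm, h3, map_zero, h1] at h4
      exact (smul_ne_zero hc0 hd) h4.symm
    have h5 : ∃ z' ∈ S, fr.ε z * m * fr.ε z' ≠ 0 := by
      by_contra! h6
      apply h2
      rw [← hmc.right, ← mul_assoc, Finset.mul_sum]
      exact Finset.sum_eq_zero h6
    obtain ⟨z', hz', h7⟩ := h5
    refine ⟨z', hz', lt_of_le_of_ne (fr.le_of_ne _ _ _ h7) ?_⟩
    rintro rfl
    exact h7 (by rw [fr.diag, hm0 z hz, zero_smul])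
  obtain ⟨z, hz, hzmax⟩ := S.exists_maximal L.nonempty
  obtain ⟨z', hz', hlt⟩ := hup z hz
  exact absurd (hzmax hz' hlt.le) (not_le_of_gt hlt)

theorem eq_zero (L : LocalCorner 𝒜 fr S) {a : A} (hc : InCorner fr S a)
    (h0 : ∀ x ∈ S, fr.ev x a = 0) : a = 0 := by
  refine hc.eq_zero fun x hx y hy => ?_
  by_cases hxy : x = y
  · rw [hxy, fr.diag, h0 y hy, zero_smul]
  · exact L.offDiag_eq_zero hx hy hxy a

theorem eq_zero_of_ev (L : LocalCorner 𝒜 fr S) {g : G} {a : A} (ha : a ∈ 𝒜 g)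
    (hc : InCorner fr S a) {x : X} (hx : x ∈ S)
    (h0 : fr.ev x a = 0) : a = 0 := by
  refine L.eq_zero hc fun y hy => ?_
  by_contra h1
  exact L.ev_ne_zero ha hc hy hx h1 h0

/-- A local corner is a group algebra. -/
theorem exists_corner (L : LocalCorner 𝒜 fr S) :
    ∃ (H : AddSubgroup G) (b : H → A), Corner 𝒜 fr S H b := by
  obtain ⟨x, hx⟩ := L.nonempty
  -- Normalizing to value `1` at `x` makes `b h` the unique such element of its degree, whence
  -- multiplicativity.
  have hex : ∀ h : L.degreeGroup, ∃ b ∈ 𝒜 (h : G), InCorner fr S b ∧ fr.ev x b = 1 := by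
    rintro ⟨h, a, ha, hc, h0⟩
    refine ⟨(fr.ev x a)⁻¹ • a, Submodule.smul_mem _ _ ha, hc.smul _, ?_⟩
    rw [map_smul, smul_eq_mul, inv_mul_cancel₀ (h0 x hx)]
  choose b hb hbc hbx using hex
  have huniq : ∀ {h : L.degreeGroup} {a : A}, a ∈ 𝒜 (h : G) → InCorner fr S a →
      a = fr.ev x a • b h := by
    intro h a ha hc
    rw [← sub_eq_zero]
    refine L.eq_zero_of_ev (sub_mem ha (Submodule.smul_mem _ _ (hb h))) (hc.sub ((hbc h).smul _))
      hx ?_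
    rw [map_sub, map_smul, hbx, smul_eq_mul, mul_one, sub_self]
  have hb0 : b 0 = ∑ x ∈ S, fr.ε x := by
    have h1 := huniq (h := 0) L.mem InCorner.unit
    rw [fr.ev_sum hx, one_smul] at h1
    exact h1.symm
  refine ⟨L.degreeGroup, b, ?_, hb, fun h k => ?_, hb0, ?_, fun a => ?_⟩
  · refine ((finite_support 𝒜).subset fun g hg hbot => ?_).to_subtype
    have h1 := hb ⟨g, hg⟩
    rw [hbot, Submodule.mem_bot] at h1
    have h2 := hbx ⟨g, hg⟩
    rw [h1, map_zero] at h2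
    exact zero_ne_one h2
  · have h1 := huniq (h := h + k) (SetLike.mul_mem_graded (hb h) (hb k)) ((hbc h).mul (hbc k))
    rwa [map_mul, hbx, hbx, one_mul, one_smul] at h1
  · intro h1
    have h2 := hbx 0
    rw [h1, map_zero] at h2
    exact zero_ne_one h2
  · have hc : InCorner fr S (b 0 * a * b 0) := by
      rw [hb0]
      exact ⟨by rw [← mul_assoc, ← mul_assoc, InCorner.unit.left],
        by rw [mul_assoc, InCorner.unit.left]⟩
    refine mem_of_proj_mem 𝒜 _ fun g => ?_
    by_cases hg : g ∈ L.degreeGroup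
    · rw [huniq (h := ⟨g, hg⟩) (proj_mem 𝒜 g _) (hc.proj L.mem g)]
      exact Submodule.smul_mem _ _ (Submodule.subset_span ⟨_, rfl⟩)
    · rw [L.eq_zero_of_ev (proj_mem 𝒜 g _) (hc.proj L.mem g) hx
        (L.ev_eq_zero_of_notMem hg (proj_mem 𝒜 g _) (hc.proj L.mem g) hx)]
      exact zero_mem _

end LocalCorner

end LocalCorner

end GradedIncidence

namespace GradedIncidence

/-! ### From a corner to an embedded group algebra -/

section GroupAlgebra

variable {F A X G : Type*} [Field F] [Ring A] [Algebra F A] [PartialOrder X] [Fintype X]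
  [AddCommGroup G] {𝒜 : G → Submodule F A} {fr : Frame F A X} {S : Finset X}
  {H : AddSubgroup G} {b : H → A}

namespace Corner

/-- The embedding of the group algebra whose image is the corner. -/
noncomputable def hom (C : Corner 𝒜 fr S H b) : AddMonoidAlgebra F H →ₙₐ[F] A :=
  AddMonoidAlgebra.liftMagma F
    { toFun := fun h => b h.toAdd
      map_mul' := fun h k => (C.mul h.toAdd k.toAdd).symm }

theorem hom_apply (C : Corner 𝒜 fr S H b) (f : AddMonoidAlgebra F H) :
    C.hom f = Finsupp.linearCombination F b f.coeff := rfl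

theorem hom_single (C : Corner 𝒜 fr S H b) (h : H) :
    C.hom (AddMonoidAlgebra.single h 1) = b h := by
  rw [hom_apply]
  simp

theorem hom_one (C : Corner 𝒜 fr S H b) : C.hom 1 = b 0 := C.hom_single 0

theorem hom_injective [DecidableEq G] [GradedAlgebra 𝒜] (C : Corner 𝒜 fr S H b) :
    Function.Injective C.hom := fun _ _ h =>
  AddMonoidAlgebra.coeff_injective (C.linearIndependent h)

theorem exists_hom_eq (C : Corner 𝒜 fr S H b) (a : A) : ∃ f, C.hom f = b 0 * a * b 0 := by
  obtain ⟨f, hf⟩ := (Finsupp.mem_span_range_iff_exists_finsupp).1 (C.span a)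
  exact ⟨.ofCoeff f, hf⟩

end Corner

end GroupAlgebra

/-! ### Existence of a triangular form -/

section Existence

variable {F A X G : Type*} [Field F] [Ring A] [Algebra F A] [PartialOrder X] [Fintype X]
  [AddCommGroup G] [DecidableEq G] (𝒜 : G → Submodule F A) [GradedAlgebra 𝒜]

/-- The unit is a sum of orthogonal idempotents that are primitive in the component of
degree `0`. -/
theorem exists_primitive_family (fr₀ : Frame F A X) :
    ∃ (t : ℕ) (e : Fin t → A), CompleteOrthogonalIdempotents e ∧
      (∀ i, e i ∈ 𝒜 0 ∧ e i ≠ 0) ∧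
      ∀ i, ∀ f ∈ 𝒜 0, IsIdempotentElem f → e i * f = f → f * e i = f → f = 0 ∨ f = e i := by
  classical
  -- Take a family of maximal length. Lengths are bounded by `|X|`, since in an adapted frame each
  -- nonzero member owns a point.
  let P : ℕ → Prop := fun t => ∃ e : Fin t → A, CompleteOrthogonalIdempotents e ∧
    ∀ i, e i ∈ 𝒜 0 ∧ e i ≠ 0
  have hbound : ∀ t, P t → t ≤ Fintype.card X := by
    rintro t ⟨e, he, h⟩
    obtain ⟨fr, c, hc⟩ := fr₀.exists_adapted he
    have hsurj : Function.Surjective c := by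
      intro i
      by_contra! h1
      apply (h i).2
      rw [hc i, Finset.filter_false_of_mem fun x _ => h1 x, Finset.sum_empty]
    simpa using Fintype.card_le_of_surjective c hsurj
  have hex : ∃ t, P t := by
    rcases subsingleton_or_nontrivial A with hA | hA
    · exact ⟨0, Fin.elim0, .of_subsingleton, fun i => i.elim0⟩
    · refine ⟨1, fun _ => 1, CompleteOrthogonalIdempotents.unique_iff.2 rfl, fun _ =>
        ⟨SetLike.GradedOne.one_mem, one_ne_zero⟩⟩
  obtain ⟨t₀, ht₀⟩ := hex
  have hPt := Nat.findGreatest_spec (hbound t₀ ht₀) ht₀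
  set t := Nat.findGreatest P (Fintype.card X) with ht
  obtain ⟨e, he, h⟩ := hPt
  refine ⟨t, e, he, h, fun i f hf hff hl hr => ?_⟩
  by_contra! hne
  have hzl : ∀ j, j ≠ i → e j * f = 0 := fun j hj => by
    rw [← hl, ← mul_assoc, he.ortho hj, zero_mul]
  have hzr : ∀ j, j ≠ i → f * e j = 0 := fun j hj => by
    rw [← hr, mul_assoc, he.ortho hj.symm, mul_zero]
  -- If `f` were neither `0` nor `e i`, replacing `e i` by `f` and `e i - f` would give a longer
  -- family.
  have hort : OrthogonalIdempotents (Function.update e i f) := by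
    refine ⟨fun j => ?_, fun j k hjk => ?_⟩
    · by_cases hj : j = i
      · subst hj
        rwa [Function.update_self]
      · rw [Function.update_of_ne hj]
        exact he.idem j
    · change Function.update e i f j * Function.update e i f k = 0
      by_cases hj : j = i
      · subst hj
        rw [Function.update_self, Function.update_of_ne hjk.symm]
        exact hzr k hjk.symm
      · rw [Function.update_of_ne hj]
        by_cases hk : k = i
        · subst hk
          rw [Function.update_self]
          exact hzl j hj
        · rw [Function.update_of_ne hk]
          exact he.ortho hjk
  have hsum : 1 - ∑ j, Function.update e i f j = e i - f := by
    rw [Finset.sum_update_of_mem (Finset.mem_univ i), ← he.complete,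
      ← Finset.add_sum_erase _ _ (Finset.mem_univ i), Finset.sdiff_singleton_eq_erase]
    abel
  have hcomp := CompleteOrthogonalIdempotents.option hort
  rw [hsum] at hcomp
  have hP : P (t + 1) := by
    refine ⟨_, (CompleteOrthogonalIdempotents.equiv (finSuccEquiv t)).2 hcomp, fun k => ?_⟩
    rw [Function.comp_apply]
    cases finSuccEquiv t k with
    | none => exact ⟨sub_mem (h i).1 hf, sub_ne_zero.2 hne.2.symm⟩
    | some j =>
      change Function.update e i f j ∈ 𝒜 0 ∧ Function.update e i f j ≠ 0
      by_cases hj : j = i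
      · subst hj
        rw [Function.update_self]
        exact ⟨hf, hne.1⟩
      · rw [Function.update_of_ne hj]
        exact h j
  have := Nat.le_findGreatest (hbound _ hP) hP
  omega

/-- A nonzero block between two corners embeds each point of the first below a point of the
second. -/
theorem Corner.exists_le {𝒜 : G → Submodule F A} [GradedAlgebra 𝒜] {fr : Frame F A X}
    {S S' : Finset X} {H H' : AddSubgroup G} {b : H → A} {b' : H' → A} (C : Corner 𝒜 fr S H b)
    (C' : Corner 𝒜 fr S' H' b') {a : A} (ha : b 0 * a * b' 0 ≠ 0) {x : X} (hx : x ∈ S) :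
    ∃ y ∈ S', x ≤ y := by
  obtain ⟨d, hd⟩ := exists_proj_ne_zero 𝒜 ha
  have h1 : b 0 * GradedAlgebra.proj 𝒜 d (b 0 * a * b' 0) =
      GradedAlgebra.proj 𝒜 d (b 0 * a * b' 0) := by
    rw [← proj_mul_left (C.mem 0), ← mul_assoc, ← mul_assoc, C.mul, add_zero]
    simp
  have h2 : GradedAlgebra.proj 𝒜 d (b 0 * a * b' 0) * b' 0 =
      GradedAlgebra.proj 𝒜 d (b 0 * a * b' 0) := by
    rw [← proj_mul_right (C'.mem 0), mul_assoc, C'.mul, add_zero]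
    simp
  have h3 := C.ε_mul_ne_zero hx (proj_mem 𝒜 d _) h1 hd
  rw [← h2, C'.zero, ← mul_assoc, Finset.mul_sum] at h3
  obtain ⟨y, hy, h4⟩ := Finset.exists_ne_zero_of_sum_ne_zero h3
  exact ⟨y, hy, fr.le_of_ne _ _ _ h4⟩

theorem exists_triangularForm [FiniteDimensional F A] (fr₀ : Frame F A X) :
    ∃ t : ℕ, Nonempty (TriangularForm 𝒜 t) := by
  classical
  obtain ⟨t, e, he, h, hprim⟩ := exists_primitive_family 𝒜 fr₀
  obtain ⟨fr, c, hc⟩ := fr₀.exists_adapted he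
  let S : Fin t → Finset X := fun i => Finset.univ.filter fun x => c x = i
  have hS : ∀ i, e i = ∑ x ∈ S i, fr.ε x := hc
  have hL : ∀ i, LocalCorner 𝒜 fr (S i) := by
    intro i
    refine ⟨?_, hS i ▸ (h i).1, fun f hf hff hfc => ?_⟩
    · rw [Finset.nonempty_iff_ne_empty]
      intro h0
      apply (h i).2
      rw [hS i, h0, Finset.sum_empty]
    · rw [← hS i]
      exact hprim i f hf hff (hS i ▸ hfc.left) (hS i ▸ hfc.right)
  choose H b C using fun i => (hL i).exists_corner
  have hbe : ∀ i, b i 0 = e i := fun i => by rw [(C i).zero, hS i]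
  let ht : X → ℕ := fun x => (Finset.univ.filter fun y => y ≤ x).card
  have htmono : ∀ x y, x < y → ht x < ht y := by
    intro x y hxy
    refine Finset.card_lt_card ⟨fun z hz => ?_, fun hsub => ?_⟩
    · exact Finset.mem_filter.2 ⟨Finset.mem_univ _, (Finset.mem_filter.1 hz).2.trans hxy.le⟩
    · have := hsub (Finset.mem_filter.2 ⟨Finset.mem_univ y, le_rfl⟩)
      exact absurd (Finset.mem_filter.1 this).2 (not_le_of_gt hxy)
  -- A block is ranked by the greatest height of its points. If the block from `i` to `j ≠ i` is
  -- nonzero, a highest point of `S i` lies strictly below a point of `S j`, so the rank increases.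
  let r : Fin t → ℕ := fun i => (S i).sup ht
  have hr : ∀ i j a, i ≠ j → e i * a * e j ≠ 0 → r i < r j := by
    intro i j a hij hne
    obtain ⟨x, hx, hxr⟩ := Finset.exists_mem_eq_sup (S i) (hL i).nonempty ht
    rw [← hbe i, ← hbe j] at hne
    obtain ⟨y, hy, hxy⟩ := (C i).exists_le (C j) hne hx
    have hne' : x ≠ y := by
      rintro rfl
      exact hij ((Finset.mem_filter.1 hx).2.symm.trans (Finset.mem_filter.1 hy).2)
    calc r i = ht x := hxr
      _ < ht y := htmono _ _ (lt_of_le_of_ne hxy hne')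
      _ ≤ r j := Finset.le_sup hy
  let σ := Tuple.sort r
  have hσ : Monotone (r ∘ σ) := Tuple.monotone_sort r
  have hone : ∀ i, (C i).hom 1 = e i := fun i => by rw [(C i).hom_one, hbe]
  refine ⟨t, ⟨{
    H := fun i => H (σ i)
    finite := fun i => (C (σ i)).finite
    ι := fun i => (C (σ i)).hom
    injective := fun i => (C (σ i)).hom_injective
    graded := fun i k => by rw [(C (σ i)).hom_single]; exact (C (σ i)).mem k
    idem := ?_
    surjective := fun i a => by rw [(C (σ i)).hom_one]; exact (C (σ i)).exists_hom_eq a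
    triangular := ?_ }⟩⟩
  · simp only [hone]
    exact (CompleteOrthogonalIdempotents.equiv σ).2 he
  · intro i j hji a
    rw [hone, hone]
    by_contra hne
    exact absurd (hr _ _ a (fun h0 => hji.ne' (σ.injective h0)) hne) (not_lt_of_ge (hσ hji.le))

theorem TriangularForm.arithmetic {𝒜 : G → Submodule F A} [GradedAlgebra 𝒜] {t : ℕ}
    (D : TriangularForm 𝒜 t) (fr₀ : Frame F A X) (i : Fin t) :
    ¬ ringChar F ∣ Nat.card (D.H i) ∧
      ∃ ζ : F, IsPrimitiveRoot ζ (AddMonoid.exponent (D.H i)) := by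
  obtain ⟨fr, c, hc⟩ := fr₀.exists_adapted D.idem
  have C := D.corner fr (hc i)
  exact ⟨C.not_ringChar_dvd, C.exists_isPrimitiveRoot⟩

end Existence

end GradedIncidence

theorem theorem2 {F : Type*} [Field F] {X : Type*} [PartialOrder X] [Fintype X] [DecidableEq X]
    [LocallyFiniteOrder X] {G : Type*} [AddCommGroup G] [DecidableEq G]
    (𝒜 : G → Submodule F (IncidenceAlgebra F X)) [GradedAlgebra 𝒜] :
    (∃ (t : ℕ) (D : GradedIncidence.TriangularForm 𝒜 t), ∀ i,
      ¬ ringChar F ∣ Nat.card (D.H i) ∧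
      ∃ ζ : F, IsPrimitiveRoot ζ (AddMonoid.exponent (D.H i))) ∧
    ∀ (t : ℕ) (D : GradedIncidence.TriangularForm 𝒜 t) (i j : Fin t), i < j →
      ∃ (s : ℕ) (χ : Fin s → AddChar (D.H i ⊓ D.H j : AddSubgroup G) F)
        (m : Fin s → IncidenceAlgebra F X) (d : Fin s → G),
        Function.Injective χ ∧
        (∀ l, m l ∈ D.block i j ∧ m l ≠ 0 ∧ m l ∈ 𝒜 (d l)) ∧
        iSupIndep (fun l => D.cyclic i j (m l)) ∧
        (⨆ l, D.cyclic i j (m l)) = D.block i j ∧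
        (∀ l (h : G) (hi : h ∈ D.H i) (hj : h ∈ D.H j),
          D.elt i ⟨h, hi⟩ * m l = χ l ⟨h, hi, hj⟩ • (m l * D.elt j ⟨h, hj⟩)) ∧
        (∀ l, GradedIncidence.GradedIso
          (GradedIncidence.shift
            (GradedIncidence.groupAlgebraGrading F (D.H i ⊔ D.H j)) (d l))
          (GradedIncidence.restrict 𝒜 (D.cyclic i j (m l)))) ∧
        s ≤ Nat.card (D.H i ⊓ D.H j : AddSubgroup G) := by
  refine ⟨?_, fun t D i j _ => D.exists_decomposition (GradedIncidence.standardFrame F X) i j⟩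
  obtain ⟨t, ⟨D⟩⟩ := GradedIncidence.exists_triangularForm 𝒜 (GradedIncidence.standardFrame F X)
  exact ⟨t, D, fun i => D.arithmetic (GradedIncidence.standardFrame F X) i⟩
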